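/- Let $\mathcal Y=\mathbb R^m$ with an arbitrary norm $\|\cdot\|$ (equivalently, a finite-dimensional real normed space), let $\|\cdot\|_*$ be the dual norm, and let $\widehat y_1,\dots,\widehat y_N\in\mathcal Y$. For a ground cost $D:\mathcal Y\times\mathcal Y\to[0,\infty)$ and probability measures $\mathbb Q_1,\mathbb Q_2$ on $\mathcal Y$ let $\mathcal W(\mathbb Q_1,\mathbb Q_2)=\inf_\pi\int D\,d\pi$ over all couplings $\pi$, and let $\mathbb B_\delta(\mathbb P)=\{\mathbb Q:\mathcal W(\mathbb Q,\mathbb P)\le\delta\}$ (empty if $\delta<0$). Let $\mathcal V\subseteq\mathbb R^N\times\mathbb R$ be a convex set of pairs $(p,\delta)$ with $p_i\ge0$ and $\sum_ip_i=1$, let $\mathcal V_+=\{(p,\delta)\in\mathcal V:\delta\ge0\}$, and assume $\mathcal V_+\neq\emptyset$. Let $\mathcal A\subseteq\mathbb R^m$ be the decision set. For $\ell:\mathbb R\to\mathbb R$ consider the union-ball conditional-expectation problem $$(\mathrm P)\qquad \inf_{\alpha\in\mathcal A}F(\alpha),\qquad F(\alpha)=\sup_{\mathbb Q\in\bigcup_{(p,\delta)\in\mathcal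 V}\mathbb B_\delta\left(\sum_{i=1}^Np_i\mathrm I_{\widehat y_i}\right)}\mathbb E_{\mathbb Q}[\ell(Y^\top\alpha)],$$ where $\mathrm I_y$ is the point mass at $y$. For $v\in\mathbb R^{N+1}$ let $\sigma^*(v\mid\mathcal V_+)=\sup_{(p,\delta)\in\mathcal V_+}\{\sum_{i=1}^Nv_ip_i+v_{N+1}\delta\}$, the convex conjugate of the indicator function of $\mathcal V_+$. All optimal values are in $[-\infty,+\infty]$. Quotients at zero are read as limits from the right: at $v_{N+1}=0$ the term $v_{N+1}\|\alpha/v_{N+1}\|_*^{q/(q-1)}$ is $0$ if $\alpha=0$ and $+\infty$ otherwise; at $y=0$ the quotient $L/y^{q-1}$ is $0$ if $L=0$ and $+\infty$ if $L>0$. A minimization problem over $\alpha\in\mathcal A$ is called equivalent to $(\mathrm P)$ if its objective coincides with $F$ on $\mathcal A$ (so that the optimal values agree, as do the minimizers). The problem $(\mathrm P)$ is said to be solved by a program in $\alpha\in\mathcal A$ and auxiliary variables if, for every $\alpha\in\mathcal A$, the infimum of the program over the auxiliary variables is $F(\alpha)$, the optimal values of the program and of $(\mathrm P)$ are equal, and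 the $\alpha$-part of every optimal solution of the program is optimal for $(\mathrm P)$. The program is convex if its feasible set is convex and its objective is convex on it. In each case below the expectations in $(\mathrm P)$ are those of integrable functions, and each program is convex whenever $\mathcal A$ is convex. (i) Let $D(y_1,y_2)=\|y_1-y_2\|$ and let $\ell$ be convex and Lipschitz continuous with smallest Lipschitz constant $\operatorname{Lip}(\ell)$. Then $(\mathrm P)$ is equivalent to $$\inf_{\alpha\in\mathcal A}\sup_{(p,\delta)\in\mathcal V_+}\sum_{i=1}^Np_i\ell(\widehat y_i^\top\alpha)+\operatorname{Lip}(\ell)\,\delta\|\alpha\|_*$$ and is solved by $$\inf_{\alpha\in\mathcal A,\,v\in\mathbb R^{N+1}}\sigma^*(v\mid\mathcal V_+)\quad\text{s.t. } v_i\ge\ell(\widehat y_i^\top\alpha)\ (i=1,\dots,N),\quad v_{N+1}\ge\operatorname{Lip}(\ell)\|\alpha\|_*.$$ (ii) Let $q\in(1,\infty)$, $C>0$, $D(y_1,y_2)=\|y_1-y_2\|^q$, $C_q^1=q^{\frac1{1-q}}-q^{\frac q{1-q}}$ and $C_q=C^{\frac q{q-1}}C_q^1$. (1) Let $\ell(x)=C(x+b)$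 or $\ell(x)=C(-x+b)$ with $b\in\mathbb R$, or $\ell(x)=C(|x-b_1|+b_2)$ with $b_1,b_2\in\mathbb R$. Then $(\mathrm P)$ is equivalent to $$\inf_{\alpha\in\mathcal A}\sup_{(p,\delta)\in\mathcal V_+}\sum_{i=1}^Np_i\ell(\widehat y_i^\top\alpha)+C\delta^{1/q}\|\alpha\|_*$$ and is solved by $$\inf_{\alpha\in\mathcal A,\,v\in\mathbb R^{N+1}}\sigma^*(v\mid\mathcal V_+)+C_qv_{N+1}\left\|\frac{\alpha}{v_{N+1}}\right\|_*^{\frac q{q-1}}\quad\text{s.t. } v_i\ge\ell(\widehat y_i^\top\alpha)\ (i=1,\dots,N),\quad v_{N+1}\ge0.$$ (2) Let $\ell(x)=(C\,\ell_0(x))^q$, where $\ell_0(x)$ is $(x-b)_+$ or $(x-b)_-=\max\{b-x,0\}$ with $b\in\mathbb R$, or $(|x-b_1|-b_2)_+$ with $b_1\in\mathbb R$, $b_2\ge0$, or $|x-b_1|+b_2$ with $b_1\in\mathbb R$, $b_2>0$. Then $(\mathrm P)$ is equivalent to $$\inf_{\alpha\in\mathcal A}\sup_{(p,\delta)\in\mathcal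 V_+}\left[\Big(\sum_{i=1}^Np_i\ell(\widehat y_i^\top\alpha)\Big)^{1/q}+C\delta^{1/q}\|\alpha\|_*\right]^q$$ and is solved by $$\inf_{\alpha\in\mathcal A,\,v\in\mathbb R^{N+1},\,y\ge0}\left[\sigma^*(v\mid\mathcal V_+)+C_q^1y+C_qv_{N+1}\left\|\frac{\alpha}{v_{N+1}}\right\|_*^{\frac q{q-1}}\right]^q\quad\text{s.t. } v_i\ge\frac{\ell(\widehat y_i^\top\alpha)}{y^{q-1}}\ (i=1,\dots,N),\quad v_{N+1}\ge0.$$ -/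

import Mathlib

open MeasureTheory Set
open scoped ENNReal NNReal

noncomputable section

namespace UnionBall

/-! ### Optimal transport cost, balls and the union-ball worst case

The outcome space is a finite-dimensional real normed space `E` (that is, `ℝ^m` with an arbitrary
norm).  A decision `α` is a linear functional on `E`, so that `yᵀα` is `α y`, and the dual norm
`‖α‖_*` is the operator norm `‖α‖`. -/

section Transport

variable {E : Type*} [MeasurableSpace E]

/-- The set of couplings of `μ` and `ν`. -/
def couplings (μ ν : Measure E) : Set (Measure (E × E)) :=
  {π | π.map Prod.fst = μ ∧ π.map Prod.snd = ν}

/-- Optimal transport cost for a (nonnegative) ground cost `D`. -/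
def transportCost (D : E → E → ℝ) (μ ν : Measure E) : ℝ≥0∞ :=
  ⨅ π ∈ couplings μ ν, ∫⁻ z, ENNReal.ofReal (D z.1 z.2) ∂π

/-- The ball of radius `δ` around `ν`.  It is empty when `δ < 0`. -/
def otBall (D : E → E → ℝ) (δ : ℝ) (ν : Measure E) : Set (Measure E) :=
  {Q | IsProbabilityMeasure Q ∧ ((transportCost D Q ν : ℝ≥0∞) : EReal) ≤ (δ : EReal)}

/-- The discrete measure `∑ i, p i • (point mass at yhat i)`. -/
def discreteMeasure {N : ℕ} (yhat : Fin N → E) (p : Fin N → ℝ) : Measure E :=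
  ∑ i, ENNReal.ofReal (p i) • Measure.dirac (yhat i)

/-- The union of the balls over all admissible pairs `(p, δ)`. -/
def unionBall {N : ℕ} (D : E → E → ℝ) (yhat : Fin N → E) (V : Set ((Fin N → ℝ) × ℝ)) :
    Set (Measure E) :=
  ⋃ x ∈ V, otBall D x.2 (discreteMeasure yhat x.1)

end Transport

/-- Worst-case expected loss `sup E_Q[ℓ(Yᵀα)]` over the union ball. -/
def worstCase {E : Type*} [NormedAddCommGroup E] [NormedSpace ℝ E] [MeasurableSpace E] {N : ℕ}
    (D : E → E → ℝ) (yhat : Fin N → E) (V : Set ((Fin N → ℝ) × ℝ)) (ℓ : ℝ → ℝ)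
    (α : StrongDual ℝ E) : EReal :=
  ⨆ Q ∈ unionBall D yhat V, ((∫ y, ℓ (α y) ∂Q : ℝ) : EReal)

/-- The ground cost `‖y₁ - y₂‖ ^ q`. -/
def powCost {E : Type*} [NormedAddCommGroup E] (q : ℝ) (y₁ y₂ : E) : ℝ := ‖y₁ - y₂‖ ^ q

/-! ### Conjugates and conventions for extended-real quantities -/

/-- `V₊`, the pairs of `V` with nonnegative radius. -/
def nonnegPart {N : ℕ} (V : Set ((Fin N → ℝ) × ℝ)) : Set ((Fin N → ℝ) × ℝ) :=
  {x | x ∈ V ∧ 0 ≤ x.2}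

/-- The inner product of `ℝ^(N+1) = ℝ^N × ℝ`. -/
def pairing {N : ℕ} (v x : (Fin N → ℝ) × ℝ) : ℝ := ∑ i, v.1 i * x.1 i + v.2 * x.2

open Classical in
/-- The convex indicator function of a set. -/
def indicatorFn {X : Type*} (S : Set X) (x : X) : EReal := if x ∈ S then 0 else ⊤

/-- The convex conjugate on `ℝ^(N+1)`. -/
def conjugate {N : ℕ} (g : (Fin N → ℝ) × ℝ → EReal) (v : (Fin N → ℝ) × ℝ) : EReal :=
  ⨆ x, ((pairing v x : ℝ) : EReal) - g x

/-- `σ*(v | S)`, the conjugate of the indicator function of `S`. -/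
def sigmaStar {N : ℕ} (S : Set ((Fin N → ℝ) × ℝ)) (v : (Fin N → ℝ) × ℝ) : EReal :=
  conjugate (indicatorFn S) v

/-- The smallest Lipschitz constant of `ℓ`. -/
def lipConst (ℓ : ℝ → ℝ) : ℝ := sInf {K : ℝ | 0 ≤ K ∧ ∀ x y, |ℓ x - ℓ y| ≤ K * |x - y|}

open Classical in
/-- `t ‖α / t‖ ^ r` for `t > 0`, extended to `t = 0` by the limit `t ↓ 0` (for `r > 1`):
`0` if `α = 0` and `+∞` otherwise. -/
def perspective {X : Type*} [NormedAddCommGroup X] [NormedSpace ℝ X] (r t : ℝ) (α : X) : EReal :=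
  if t = 0 then (if α = 0 then 0 else ⊤) else ((t * ‖t⁻¹ • α‖ ^ r : ℝ) : EReal)

open Classical in
/-- The quotient `L / s` of nonnegative numbers, where `0 / 0 = 0` and `L / 0 = +∞` for `L > 0`. -/
def quotient (L s : ℝ) : EReal :=
  if s = 0 then (if L = 0 then 0 else ⊤) else ((L / s : ℝ) : EReal)

/-- `x ^ q` for `x ∈ [0, +∞]`. -/
def epow (x : EReal) (q : ℝ) : EReal := ((x.toENNReal ^ q : ℝ≥0∞) : EReal)

/-! ### Optimization problems -/

/-- Minimizing `F` over `A` and minimizing `G` over `A` are equivalent: the objectives agree on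
`A`, and the two problems have the same optimal value. -/
def EquivalentProblems {X : Type*} (A : Set X) (F G : X → EReal) : Prop :=
  (∀ α ∈ A, F α = G α) ∧ (⨅ α ∈ A, F α) = ⨅ α ∈ A, G α

/-- Minimizing `F` over `A` is solved by minimizing `obj` over the set `K` of feasible pairs
(decision, auxiliary variables): for each fixed decision the optimal value over the auxiliary
variables is `F`, the optimal values of both problems agree, and the decision part of an optimal
solution is optimal. -/
def SolvedBy {X W : Type*} (A : Set X) (F : X → EReal) (K : Set (X × W)) (obj : X × W → EReal) :
    Prop :=
  (∀ z ∈ K, z.1 ∈ A) ∧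
  (∀ α ∈ A, F α = ⨅ w ∈ {w | (α, w) ∈ K}, obj (α, w)) ∧
  (⨅ α ∈ A, F α) = (⨅ z ∈ K, obj z) ∧
  (∀ z ∈ K, IsMinOn obj K z → IsMinOn F A z.1)

/-- Minimizing the extended-real function `obj` over `K` is a convex program: the feasible set is
convex, and so is `obj` on it (its epigraph is convex). -/
def IsConvexProgram {Z : Type*} [AddCommGroup Z] [Module ℝ Z] (K : Set Z) (obj : Z → EReal) :
    Prop :=
  Convex ℝ K ∧ Convex ℝ {x : Z × ℝ | x.1 ∈ K ∧ obj x.1 ≤ (x.2 : EReal)}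

/-! ### The losses -/

/-- `C (x + b)`, `C (-x + b)` or `C (|x - b₁| + b₂)`. -/
def IsAffineOrAbsLoss (C : ℝ) (ℓ : ℝ → ℝ) : Prop :=
  (∃ b : ℝ, ℓ = fun x => C * (x + b)) ∨
  (∃ b : ℝ, ℓ = fun x => C * (-x + b)) ∨
  (∃ b₁ b₂ : ℝ, ℓ = fun x => C * (|x - b₁| + b₂))

/-- `(C ℓᵢ(x)) ^ q` for one of the four forms of `ℓᵢ`. -/
def IsPowerLoss (q C : ℝ) (ℓ : ℝ → ℝ) : Prop :=
  (∃ b : ℝ, ℓ = fun x => (C * max (x - b) 0) ^ q) ∨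
  (∃ b : ℝ, ℓ = fun x => (C * max (-(x - b)) 0) ^ q) ∨
  (∃ b₁ b₂ : ℝ, 0 ≤ b₂ ∧ ℓ = fun x => (C * max (|x - b₁| - b₂) 0) ^ q) ∨
  (∃ b₁ b₂ : ℝ, 0 < b₂ ∧ ℓ = fun x => (C * (|x - b₁| + b₂)) ^ q)

/-- `C_q^1 = q^(1/(1-q)) - q^(q/(1-q))`. -/
def constOne (q : ℝ) : ℝ := q ^ (1 / (1 - q)) - q ^ (q / (1 - q))

/-- `C_q = C^(q/(q-1)) (q^(1/(1-q)) - q^(q/(1-q)))`. -/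
def constTwo (q C : ℝ) : ℝ := C ^ (q / (q - 1)) * (q ^ (1 / (1 - q)) - q ^ (q / (1 - q)))

/-! ### The robust objectives and the programs -/

section Programs

variable {E : Type*} [NormedAddCommGroup E] [NormedSpace ℝ E] {N : ℕ}

/-- `sup_{V₊} ∑ pᵢ ℓ(ŷᵢᵀα) + Lip(ℓ) δ ‖α‖_*`. -/
def robustLipschitz (yhat : Fin N → E) (V : Set ((Fin N → ℝ) × ℝ)) (ℓ : ℝ → ℝ)
    (α : StrongDual ℝ E) : EReal :=
  ⨆ x ∈ nonnegPart V, ((∑ i, x.1 i * ℓ (α (yhat i)) + lipConst ℓ * x.2 * ‖α‖ : ℝ) : EReal)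

/-- `sup_{V₊} ∑ pᵢ ℓ(ŷᵢᵀα) + C δ^(1/q) ‖α‖_*`. -/
def robustAffine (q C : ℝ) (yhat : Fin N → E) (V : Set ((Fin N → ℝ) × ℝ)) (ℓ : ℝ → ℝ)
    (α : StrongDual ℝ E) : EReal :=
  ⨆ x ∈ nonnegPart V, ((∑ i, x.1 i * ℓ (α (yhat i)) + C * x.2 ^ (1 / q) * ‖α‖ : ℝ) : EReal)

/-- `sup_{V₊} [(∑ pᵢ ℓ(ŷᵢᵀα))^(1/q) + C δ^(1/q) ‖α‖_*]^q`. -/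
def robustPower (q C : ℝ) (yhat : Fin N → E) (V : Set ((Fin N → ℝ) × ℝ)) (ℓ : ℝ → ℝ)
    (α : StrongDual ℝ E) : EReal :=
  ⨆ x ∈ nonnegPart V,
    ((((∑ i, x.1 i * ℓ (α (yhat i))) ^ (1 / q) + C * x.2 ^ (1 / q) * ‖α‖) ^ q : ℝ) : EReal)

/-- Feasible `(α, v)` of the first program. -/
def feasibleLipschitz (A : Set (StrongDual ℝ E)) (yhat : Fin N → E) (ℓ : ℝ → ℝ) :
    Set (StrongDual ℝ E × ((Fin N → ℝ) × ℝ)) :=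
  {z | z.1 ∈ A ∧ (∀ i, ℓ (z.1 (yhat i)) ≤ z.2.1 i) ∧ lipConst ℓ * ‖z.1‖ ≤ z.2.2}

/-- Objective `σ*(v | V₊)` of the first program. -/
def objLipschitz (V : Set ((Fin N → ℝ) × ℝ)) (z : StrongDual ℝ E × ((Fin N → ℝ) × ℝ)) : EReal :=
  sigmaStar (nonnegPart V) z.2

/-- Feasible `(α, v)` of the second program. -/
def feasibleAffine (A : Set (StrongDual ℝ E)) (yhat : Fin N → E) (ℓ : ℝ → ℝ) :
    Set (StrongDual ℝ E × ((Fin N → ℝ) × ℝ)) :=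
  {z | z.1 ∈ A ∧ (∀ i, ℓ (z.1 (yhat i)) ≤ z.2.1 i) ∧ 0 ≤ z.2.2}

/-- Objective `σ*(v | V₊) + C_q v_{N+1} ‖α / v_{N+1}‖_*^(q/(q-1))` of the second program. -/
def objAffine (q C : ℝ) (V : Set ((Fin N → ℝ) × ℝ))
    (z : StrongDual ℝ E × ((Fin N → ℝ) × ℝ)) : EReal :=
  sigmaStar (nonnegPart V) z.2 + (constTwo q C : EReal) * perspective (q / (q - 1)) z.2.2 z.1

/-- Feasible `(α, (v, y))` of the third program. -/
def feasiblePower (q : ℝ) (A : Set (StrongDual ℝ E)) (yhat : Fin N → E) (ℓ : ℝ → ℝ) :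
    Set (StrongDual ℝ E × (((Fin N → ℝ) × ℝ) × ℝ)) :=
  {z | z.1 ∈ A ∧ 0 ≤ z.2.2 ∧
    (∀ i, quotient (ℓ (z.1 (yhat i))) (z.2.2 ^ (q - 1)) ≤ (z.2.1.1 i : EReal)) ∧ 0 ≤ z.2.1.2}

/-- Objective `[σ*(v | V₊) + C_q^1 y + C_q v_{N+1} ‖α / v_{N+1}‖_*^(q/(q-1))]^q` of the third
program. -/
def objPower (q C : ℝ) (V : Set ((Fin N → ℝ) × ℝ))
    (z : StrongDual ℝ E × (((Fin N → ℝ) × ℝ) × ℝ)) : EReal :=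
  epow (sigmaStar (nonnegPart V) z.2.1 + ((constOne q * z.2.2 : ℝ) : EReal)
    + (constTwo q C : EReal) * perspective (q / (q - 1)) z.2.1.2 z.1) q

end Programs

end UnionBall

end

noncomputable section

namespace UnionBall

/-! The argument has two halves: evaluate the worst case for each fixed decision `α`, then dualize
the supremum over `V₊`.

Worst case, upper bound. A nearly optimal coupling has displacement of `L^q` norm about `δ^(1/q)`,
so a `K`-Lipschitz function of `α y` changes by at most `K ‖α‖ δ^(1/q)` in `L^q`. Monotonicity of
`L^p` norms bounds the mean (`integral_le_of_lipschitz`), and Minkowski's inequality bounds the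
`q`-th root of a `q`-th moment (`integral_rpow_le_of_lipschitz`). Lower bound: move mass along a
vector norming `α` (`shifted_risk_le`). Full mass is moved when the loss grows at its full rate at
once, a vanishing mass very far when the growth is only asymptotic.

Duality. By Young's inequality (`young_iff`) the perspective term is the least `c` with `C ‖α‖
d^(1/q) ≤ v_{N+1} d + c` for all `d ≥ 0`, and the quotient constraint has a similar form. Taking `d
= δ` gives weak duality; these families of inequalities also show that the programs are convex.
Conversely, the robust objective maximizes a concave function of two numbers, nominal risk and
radius, over a convex set. Separating that set from a hypograph produces the multipliers
(`affine_duality`, `power_duality`), up to an arbitrarily small loss, which suffices for equality of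
infima. The Lipschitz program is linear in `δ` and needs only monotonicity. -/

/-! ### Young's inequality and the perspective term -/

lemma constOne_eq {q : ℝ} (hq : 1 < q) :
    constOne q = (1 - 1 / q) * q ^ (1 / (1 - q)) := by
  have h0 : 0 < q := by linarith
  have h1 : q / (1 - q) = 1 / (1 - q) - 1 := by
    have : 1 - q ≠ 0 := by linarith
    field_simp
    ring
  rw [constOne, h1, Real.rpow_sub_one h0.ne']
  ring

lemma constOne_pos {q : ℝ} (hq : 1 < q) : 0 < constOne q := by
  have h0 : 0 < q := by linarith
  rw [constOne_eq hq]
  have : 1 / q < 1 := by rw [div_lt_one h0]; exact hq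
  exact mul_pos (by linarith) (Real.rpow_pos_of_pos h0 _)

/-- Weighted AM-GM for `q * x` and `q ^ (1 / (1 - q)) * y`: this scaling makes the factors `q ^ (1 /
q)` and `q ^ (-(1 / q))` cancel on the left and leaves coefficient `1` on `x`. -/
lemma rpow_mul_rpow_le {q x y : ℝ} (hq : 1 < q) (hx : 0 ≤ x) (hy : 0 ≤ y) :
    x ^ (1 / q) * y ^ (1 - 1 / q) ≤ x + constOne q * y := by
  have h0 : 0 < q := by linarith
  have h1 : 1 / q < 1 := by rw [div_lt_one h0]; exact hq
  have h := Real.geom_mean_le_arith_mean2_weighted (w₁ := 1 / q) (w₂ := 1 - 1 / q)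
    (p₁ := q * x) (p₂ := q ^ (1 / (1 - q)) * y) (by positivity) (by linarith) (by positivity)
    (by positivity) (by ring)
  rw [Real.mul_rpow h0.le hx, Real.mul_rpow (by positivity) hy, ← Real.rpow_mul h0.le] at h
  have h2 : 1 / (1 - q) * (1 - 1 / q) = -(1 / q) := by
    have : 1 - q ≠ 0 := by linarith
    field_simp
    ring
  have h3 : q ^ (1 / q) * q ^ (-(1 / q)) = 1 := by
    rw [← Real.rpow_add h0]; simp
  have h4 : 1 / q * (q * x) = x := by field_simp
  rw [h2, h4] at h
  rw [constOne_eq hq]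
  calc x ^ (1 / q) * y ^ (1 - 1 / q)
      = (q ^ (1 / q) * q ^ (-(1 / q))) * (x ^ (1 / q) * y ^ (1 - 1 / q)) := by rw [h3, one_mul]
    _ = _ := by ring
    _ ≤ _ := h
    _ = _ := by ring

/-- Young's inequality as a dual description of the hypograph of a geometric mean. -/
lemma young_iff {q a t y : ℝ} (hq : 1 < q) (ha : 0 ≤ a) (ht : 0 ≤ t) (hy : 0 ≤ y) :
    (∀ d : ℝ, 0 ≤ d → a * d ^ (1 / q) ≤ t * d + constOne q * y) ↔ a ^ q ≤ t * y ^ (q - 1) := by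
  have h0 : 0 < q := by linarith
  constructor
  · intro h
    -- Both `t` and `y` may vanish, so they are perturbed by `e` and the limit `e ↓ 0` is taken at
    -- the end.
    have key : ∀ e : ℝ, 0 < e → a ^ q ≤ (t + e) * (y + e) ^ (q - 1) := by
      intro e he
      have hT : 0 < t + e := by linarith
      have hY : 0 < y + e := by linarith
      set K := q ^ (q / (1 - q)) with hK
      have hK0 : 0 < K := Real.rpow_pos_of_pos h0 _
      -- This `d` is the tangency point of the two sides in the equality case of Young's inequality
      -- with `t + e` and `y + e`.
      have h1 := h (K * (y + e) / (t + e)) (by positivity)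
      have h2 : a * (K * (y + e) / (t + e)) ^ (1 / q) ≤ q ^ (1 / (1 - q)) * (y + e) := by
        have e1 : t * (K * (y + e) / (t + e)) ≤ (t + e) * (K * (y + e) / (t + e)) :=
          mul_le_mul_of_nonneg_right (by linarith) (by positivity)
        have e2 : (t + e) * (K * (y + e) / (t + e)) = K * (y + e) := by field_simp
        have e3 : constOne q * y ≤ constOne q * (y + e) :=
          mul_le_mul_of_nonneg_left (by linarith) (constOne_pos hq).le
        have e4 : constOne q = q ^ (1 / (1 - q)) - K := rfl
        nlinarith
      have h3 := Real.rpow_le_rpow (by positivity) h2 h0.le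
      rw [Real.mul_rpow ha (by positivity), ← Real.rpow_mul (by positivity), one_div_mul_cancel h0.ne',
        Real.rpow_one, Real.mul_rpow (by positivity) hY.le, ← Real.rpow_mul h0.le,
        one_div_mul_eq_div, ← hK] at h3
      have h4 : (y + e) ^ q = (y + e) ^ (q - 1) * (y + e) := by
        rw [Real.rpow_sub_one hY.ne']; field_simp
      rw [h4] at h3
      have h5 : a ^ q * (K * (y + e)) ≤ (t + e) * (y + e) ^ (q - 1) * (K * (y + e)) := by
        calc a ^ q * (K * (y + e)) = (a ^ q * (K * (y + e) / (t + e))) * (t + e) := by field_simp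
          _ ≤ (K * ((y + e) ^ (q - 1) * (y + e))) * (t + e) :=
            mul_le_mul_of_nonneg_right h3 hT.le
          _ = _ := by ring
      exact le_of_mul_le_mul_right h5 (by positivity)
    have hc : Continuous fun e : ℝ => (t + e) * (y + e) ^ (q - 1) :=
      (continuous_const.add continuous_id).mul
        ((continuous_const.add continuous_id).rpow_const fun _ => Or.inr (by linarith))
    have hcl : IsClosed {e : ℝ | a ^ q ≤ (t + e) * (y + e) ^ (q - 1)} :=
      isClosed_le continuous_const hc
    have : Ici (0 : ℝ) ⊆ {e : ℝ | a ^ q ≤ (t + e) * (y + e) ^ (q - 1)} := by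
      rw [← closure_Ioi]
      exact hcl.closure_subset_iff.2 fun e he => key e he
    simpa using this (mem_Ici.2 le_rfl)
  · intro h d hd
    have h1 : a ≤ t ^ (1 / q) * y ^ (1 - 1 / q) := by
      have h2 := Real.rpow_le_rpow (by positivity) h (z := 1 / q) (by positivity)
      rw [← Real.rpow_mul ha, mul_one_div_cancel h0.ne', Real.rpow_one,
        Real.mul_rpow ht (by positivity), ← Real.rpow_mul hy] at h2
      convert h2 using 3
      field_simp
    calc a * d ^ (1 / q) ≤ t ^ (1 / q) * y ^ (1 - 1 / q) * d ^ (1 / q) :=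
          mul_le_mul_of_nonneg_right h1 (by positivity)
      _ = (t * d) ^ (1 / q) * y ^ (1 - 1 / q) := by rw [Real.mul_rpow ht hd]; ring
      _ ≤ _ := rpow_mul_rpow_le hq (by positivity) hy

lemma constTwo_eq {q C : ℝ} : constTwo q C = C ^ (q / (q - 1)) * constOne q := rfl

lemma constTwo_pos {q C : ℝ} (hq : 1 < q) (hC : 0 < C) : 0 < constTwo q C :=
  mul_pos (Real.rpow_pos_of_pos hC _) (constOne_pos hq)

lemma perspective_nonneg {X : Type*} [NormedAddCommGroup X] [NormedSpace ℝ X] {r t : ℝ} {α : X}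
    (ht : 0 ≤ t) : 0 ≤ perspective r t α := by
  unfold perspective
  split_ifs
  · exact le_rfl
  · exact le_top
  · exact_mod_cast by positivity

/-- Dual description of the perspective term. -/
lemma constTwo_mul_perspective_le_iff {X : Type*} [NormedAddCommGroup X] [NormedSpace ℝ X]
    {q C t c : ℝ} {α : X} (hq : 1 < q) (hC : 0 < C) (ht : 0 ≤ t) :
    (constTwo q C : EReal) * perspective (q / (q - 1)) t α ≤ (c : EReal) ↔
      ∀ d : ℝ, 0 ≤ d → C * ‖α‖ * d ^ (1 / q) ≤ t * d + c := by
  have h0 : 0 < q := by linarith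
  have hq1 : 0 < q - 1 := by linarith
  have h1 := constOne_pos hq
  have hL : (constTwo q C : EReal) * perspective (q / (q - 1)) t α ≤ (c : EReal) → 0 ≤ c := by
    intro h
    have : (0 : EReal) ≤ c := le_trans (mul_nonneg (by exact_mod_cast (constTwo_pos hq hC).le)
      (perspective_nonneg ht)) h
    exact_mod_cast this
  have hR : (∀ d : ℝ, 0 ≤ d → C * ‖α‖ * d ^ (1 / q) ≤ t * d + c) → 0 ≤ c := by
    intro h
    have := h 0 le_rfl
    rwa [Real.zero_rpow (by positivity), mul_zero, mul_zero, zero_add] at this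
  -- Either side forces `c ≥ 0` (take `d = 0` on the right), so `c` can be written as `constOne q *
  -- y` and `young_iff` applies with `a = C * ‖α‖`.
  rcases lt_or_ge c 0 with hc | hc
  · exact ⟨fun h => absurd (hL h) hc.not_ge, fun h => absurd (hR h) hc.not_ge⟩
  obtain ⟨y, hy, rfl⟩ : ∃ y, 0 ≤ y ∧ c = constOne q * y :=
    ⟨c / constOne q, by positivity, by field_simp⟩
  rw [young_iff hq (by positivity) ht hy]
  unfold perspective
  split_ifs with h2 h3
  · subst h2 h3
    simp only [mul_zero, norm_zero, zero_mul]
    rw [Real.zero_rpow h0.ne']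
    simpa using (show (0 : EReal) ≤ ((constOne q * y : ℝ) : EReal) from
      EReal.coe_nonneg.2 (by positivity))
  · subst h2
    rw [EReal.coe_mul_top_of_pos (constTwo_pos hq hC)]
    have : 0 < ‖α‖ := norm_pos_iff.2 h3
    have : 0 < (C * ‖α‖) ^ q := by positivity
    constructor
    · intro h; exact absurd (top_le_iff.1 h) (EReal.coe_ne_top _)
    · intro h; rw [zero_mul] at h; linarith
  · have ht' : 0 < t := lt_of_le_of_ne ht (Ne.symm h2)
    rw [← EReal.coe_mul, EReal.coe_le_coe_iff, constTwo_eq, norm_smul, Real.norm_eq_abs,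
      abs_of_pos (inv_pos.2 ht')]
    have e1 : C ^ (q / (q - 1)) * constOne q * (t * (t⁻¹ * ‖α‖) ^ (q / (q - 1))) =
        constOne q * (t * (t⁻¹ * (C * ‖α‖)) ^ (q / (q - 1))) := by
      rw [show t⁻¹ * (C * ‖α‖) = C * (t⁻¹ * ‖α‖) by ring,
        Real.mul_rpow hC.le (by positivity : 0 ≤ t⁻¹ * ‖α‖)]
      ring
    rw [e1, mul_le_mul_iff_right₀ h1]
    set a := C * ‖α‖
    have ha : 0 ≤ a := by positivity
    rw [← Real.rpow_le_rpow_iff (by positivity) hy hq1, Real.mul_rpow ht (by positivity),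
      ← Real.rpow_mul (by positivity), div_mul_cancel₀ _ hq1.ne', Real.mul_rpow (by positivity) ha,
      Real.inv_rpow ht, Real.rpow_sub_one ht'.ne']
    have : 0 < t ^ q := by positivity
    rw [show t ^ q / t * ((t ^ q)⁻¹ * a ^ q) = a ^ q / t by field_simp, div_le_iff₀ ht', mul_comm t]

/-- The conjunct `0 ≤ v` cannot be dropped: when the denominator and `L` vanish, the quotient is
`0`, while the product inequality says nothing about `v`. -/
lemma quotient_le_iff {q L v y : ℝ} (hL : 0 ≤ L) (hy : 0 ≤ y) :
    quotient L (y ^ (q - 1)) ≤ (v : EReal) ↔ 0 ≤ v ∧ L ≤ v * y ^ (q - 1) := by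
  unfold quotient
  split_ifs with h1 h2
  · simp [h1, h2]
  · rw [h1]
    constructor
    · intro h; exact absurd h (by simp)
    · rintro ⟨_, h⟩
      exact absurd (le_antisymm (by simpa using h) hL) h2
  · have : 0 < y ^ (q - 1) := lt_of_le_of_ne (by positivity) (Ne.symm h1)
    rw [EReal.coe_le_coe_iff, div_le_iff₀ this]
    refine ⟨fun h => ⟨?_, h⟩, fun h => h.2⟩
    by_contra hv
    have := mul_neg_of_neg_of_pos (not_le.1 hv) this
    linarith

/-! ### Extended-real inequalities through real upper bounds -/

lemma toENNReal_le_ofReal_iff {X : EReal} {s : ℝ} (hs : 0 ≤ s) :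
    X.toENNReal ≤ ENNReal.ofReal s ↔ X ≤ (s : EReal) := by
  rw [← EReal.coe_ennreal_le_coe_ennreal_iff, EReal.coe_toENNReal_eq_max, EReal.coe_ennreal_ofReal,
    max_eq_left hs, max_le_iff, and_iff_right (EReal.coe_nonneg.2 hs)]

lemma epow_le_iff {q s : ℝ} {X : EReal} (hq : 0 < q) :
    epow X q ≤ (s : EReal) ↔ 0 ≤ s ∧ X ≤ ((s ^ (1 / q) : ℝ) : EReal) := by
  unfold epow
  rcases lt_or_ge s 0 with hs | hs
  · refine ⟨fun h => ?_, fun h => absurd h.1 hs.not_ge⟩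
    have : (0 : EReal) ≤ s := le_trans (EReal.coe_ennreal_nonneg _) h
    exact absurd (EReal.coe_nonneg.1 this) hs.not_ge
  · have h1 : ((s : ℝ) : EReal) = ((ENNReal.ofReal s : ℝ≥0∞) : EReal) := by
      rw [EReal.coe_ennreal_ofReal, max_eq_left hs]
    rw [h1, EReal.coe_ennreal_le_coe_ennreal_iff, ← ENNReal.le_rpow_inv_iff hq,
      ENNReal.ofReal_rpow_of_nonneg hs (by positivity), toENNReal_le_ofReal_iff (by positivity),
      and_iff_right hs, one_div]

/-- Neither summand may be `⊥`, since `⊥ + ⊤ = ⊥` in `EReal` is below every `s` although `⊤` has no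
real bound. -/
lemma add_le_coe_iff {a b : EReal} {s : ℝ} (ha : a ≠ ⊥) (hb : b ≠ ⊥) :
    a + b ≤ (s : EReal) ↔ ∃ c₁ c₂ : ℝ, a ≤ c₁ ∧ b ≤ c₂ ∧ c₁ + c₂ ≤ s := by
  constructor
  · intro h
    induction a with
    | bot => exact absurd rfl ha
    | top => rw [EReal.top_add_of_ne_bot hb] at h; exact absurd h (by simp)
    | coe a =>
      induction b with
      | bot => exact absurd rfl hb
      | top => rw [EReal.coe_add_top] at h; exact absurd h (by simp)
      | coe b => exact ⟨a, b, le_rfl, le_rfl, by exact_mod_cast h⟩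
  · rintro ⟨c₁, c₂, h1, h2, h3⟩
    exact (add_le_add h1 h2).trans (by exact_mod_cast h3)

lemma le_of_forall_coe_le {a b : EReal} (h : ∀ s : ℝ, b ≤ s → a ≤ s) : a ≤ b := by
  induction b with
  | bot =>
    rw [le_bot_iff, EReal.eq_bot_iff_forall_lt]
    intro y
    exact lt_of_le_of_lt (h (y - 1) bot_le) (by exact_mod_cast sub_one_lt y)
  | top => exact le_top
  | coe b => exact h b le_rfl

section Sigma
variable {N : ℕ}

lemma sigmaStar_le_iff {S : Set ((Fin N → ℝ) × ℝ)} {v : (Fin N → ℝ) × ℝ} {s : ℝ} :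
    sigmaStar S v ≤ (s : EReal) ↔ ∀ x ∈ S, pairing v x ≤ s := by
  unfold sigmaStar conjugate indicatorFn
  rw [iSup_le_iff]
  refine forall_congr' fun x => ?_
  split_ifs with h
  · simp [h]
  · simp [h]

lemma sigmaStar_ne_bot {S : Set ((Fin N → ℝ) × ℝ)} (hS : S.Nonempty) (v : (Fin N → ℝ) × ℝ) :
    sigmaStar S v ≠ ⊥ := by
  obtain ⟨x, hx⟩ := hS
  intro h
  have := sigmaStar_le_iff.1 (h.le.trans bot_le : sigmaStar S v ≤ ((pairing v x - 1 : ℝ) : EReal)) x hx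
  linarith

end Sigma

/-- `h2` is weak duality; `h3` is strong duality with the slack `s < s'`, so no attainment in the
auxiliary variables is required. -/
lemma SolvedBy.of_forall_coe {X W : Type*} {A : Set X} {F : X → EReal} {K : Set (X × W)}
    {obj : X × W → EReal} (h1 : ∀ z ∈ K, z.1 ∈ A)
    (h2 : ∀ z ∈ K, ∀ s : ℝ, obj z ≤ s → F z.1 ≤ s)
    (h3 : ∀ α ∈ A, ∀ s s' : ℝ, F α ≤ s → s < s' → ∃ w, (α, w) ∈ K ∧ obj (α, w) ≤ s') :
    SolvedBy A F K obj := by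
  have hle : ∀ z ∈ K, F z.1 ≤ obj z := fun z hz => le_of_forall_coe_le (h2 z hz)
  have hval : ∀ α ∈ A, F α = ⨅ w ∈ {w | (α, w) ∈ K}, obj (α, w) := by
    intro α hα
    refine le_antisymm (le_iInf₂ fun w hw => hle (α, w) hw) (le_of_forall_coe_le fun s hs => ?_)
    refine EReal.le_of_forall_lt_iff_le.1 fun s' hs' => ?_
    obtain ⟨w, hw, hw'⟩ := h3 α hα s s' hs (by exact_mod_cast hs')
    exact (iInf₂_le w hw).trans hw'
  refine ⟨h1, hval, le_antisymm ?_ ?_, ?_⟩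
  · exact le_iInf₂ fun z hz => (iInf₂_le z.1 (h1 z hz)).trans (hle z hz)
  · refine le_iInf₂ fun α hα => ?_
    rw [hval α hα]
    exact le_iInf₂ fun w hw => iInf₂_le (α, w) hw
  · intro z hz hmin α hα
    show F z.1 ≤ F α
    rw [hval α hα]
    exact le_iInf₂ fun w hw => (hle z hz).trans (hmin hw)

/-! ### Separation and the two planar duality statements -/

/-- Fenchel duality for a concave function on an open set, by separation. -/
lemma exists_linear_of_concave_le {F : Type*} [NormedAddCommGroup F] [NormedSpace ℝ F]
    {S U : Set F} {Φ : F → ℝ} {M : ℝ} (hS : Convex ℝ S) (hSne : S.Nonempty) (hSU : S ⊆ U)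
    (hU : IsOpen U) (hΦ : ConcaveOn ℝ U Φ) (hΦc : ContinuousOn Φ U) (hM : ∀ x ∈ S, Φ x ≤ M) :
    ∃ g : F →L[ℝ] ℝ, ∀ x ∈ S, ∀ x' ∈ U, g x + (Φ x' - g x') ≤ M := by
  have hopen : IsOpen {z : F × ℝ | z.1 ∈ U ∧ z.2 < Φ z.1} := by
    have h1 : IsOpen {z : F × ℝ | z.1 ∈ U} := hU.preimage continuous_fst
    have h2 : ContinuousOn (fun z : F × ℝ => Φ z.1 - z.2) {z : F × ℝ | z.1 ∈ U} :=
      (hΦc.comp continuousOn_fst fun z hz => hz).sub continuousOn_snd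
    have h3 := h2.isOpen_inter_preimage h1 (isOpen_Ioi (a := (0 : ℝ)))
    convert h3 using 1
    ext z
    simp
  obtain ⟨f, u, hf1, hf2⟩ := geometric_hahn_banach_open hΦ.convex_strict_hypograph hopen
    (t := S ×ˢ {M}) (hS.prod (convex_singleton M)) (by
      rw [Set.disjoint_left]
      rintro ⟨x, s⟩ ⟨_, h⟩ ⟨hx, hs⟩
      simp only [mem_singleton_iff] at hs
      subst hs
      exact absurd (hM x hx) (not_le.2 h))
  set b := f (0, 1) with hb
  have hdec : ∀ x s, f (x, s) = f (x, 0) + s * b := by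
    intro x s
    rw [hb, ← smul_eq_mul, ← map_smul, ← map_add]
    simp
  -- `S` lies inside the open domain `U`, so the separating hyperplane cannot be vertical; dividing
  -- by `b` then gives an affine majorant of `Φ`.
  have hbpos : 0 < b := by
    obtain ⟨x, hx⟩ := hSne
    have e1 := hf1 (x, Φ x - 1) ⟨hSU hx, by simp⟩
    have e2 := hf2 (x, M) ⟨hx, rfl⟩
    rw [hdec] at e1 e2
    have := hM x hx
    by_contra hn
    nlinarith
  refine ⟨-b⁻¹ • f.comp (ContinuousLinearMap.inl ℝ F ℝ), fun x hx x' hx' => ?_⟩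
  have e1 : f (x', 0) + Φ x' * b ≤ u := by
    refine le_of_forall_pos_lt_add fun e he => ?_
    have := hf1 (x', Φ x' - e / b) ⟨hx', by simp; positivity⟩
    rw [hdec, sub_mul, div_mul_cancel₀ _ hbpos.ne'] at this
    linarith
  have e2 := hf2 (x, M) ⟨hx, rfl⟩
  rw [hdec] at e2
  simp only [smul_apply, ContinuousLinearMap.comp_apply,
    ContinuousLinearMap.inl_apply, smul_eq_mul]
  have e3 : f (x', 0) + Φ x' * b ≤ f (x, 0) + M * b := e1.trans e2
  have e4 : b⁻¹ * (f (x', 0) + Φ x' * b) ≤ b⁻¹ * (f (x, 0) + M * b) :=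
    mul_le_mul_of_nonneg_left e3 (by positivity)
  have e5 : b⁻¹ * b = 1 := inv_mul_cancel₀ hbpos.ne'
  have e6 : b⁻¹ * (f (x', 0) + Φ x' * b) = b⁻¹ * f (x', 0) + Φ x' * (b⁻¹ * b) := by ring
  have e7 : b⁻¹ * (f (x, 0) + M * b) = b⁻¹ * f (x, 0) + M * (b⁻¹ * b) := by ring
  rw [e6, e7, e5] at e4
  linarith

/-- Take `c` to be the supremum of `f` on `A`. This divides a joint bound into separate budgets for
the terms of a program's objective. -/
lemma exists_split_bound {ι κ : Type*} {A : Set ι} {B : Set κ} (hA : A.Nonempty) (hB : B.Nonempty)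
    {f : ι → ℝ} {g : κ → ℝ} {K : ℝ} (h : ∀ i ∈ A, ∀ j ∈ B, f i + g j ≤ K) :
    ∃ c : ℝ, (∀ i ∈ A, f i ≤ c) ∧ ∀ j ∈ B, g j ≤ K - c := by
  have hbdd : ∀ j ∈ B, K - g j ∈ upperBounds (f '' A) := by
    rintro j hj _ ⟨i, hi, rfl⟩
    linarith [h i hi j hj]
  obtain ⟨j₀, hj₀⟩ := hB
  refine ⟨sSup (f '' A), fun i hi => le_csSup ⟨_, hbdd j₀ hj₀⟩ (mem_image_of_mem f hi),
    fun j hj => ?_⟩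
  linarith [csSup_le (hA.image f) (hbdd j hj)]

/-- If `t` were negative, a large `d` would make the right side negative. -/
lemma nonneg_of_forall_rpow_le {q c t k : ℝ} (hc : 0 ≤ c)
    (h : ∀ d : ℝ, 0 < d → c * d ^ (1 / q) ≤ t * d + k) : 0 ≤ t := by
  by_contra ht
  have ht' : t < 0 := not_le.1 ht
  have hd : 0 < (|k| + 1) / -t := div_pos (by positivity) (by linarith)
  have h1 := h _ hd
  have h2 : t * ((|k| + 1) / -t) = -(|k| + 1) := by
    rw [div_neg, mul_neg, mul_div_cancel₀ _ ht'.ne]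
  have h3 : 0 ≤ c * ((|k| + 1) / -t) ^ (1 / q) := by positivity
  linarith [le_abs_self k]

lemma forall_nonneg_rpow_le {q c t k : ℝ} (hq : 0 < q)
    (h : ∀ d : ℝ, 0 < d → c * d ^ (1 / q) ≤ t * d + k) (d : ℝ) (hd : 0 ≤ d) :
    c * d ^ (1 / q) ≤ t * d + k := by
  have hcl : IsClosed {d : ℝ | c * d ^ (1 / q) ≤ t * d + k} :=
    isClosed_le (continuous_const.mul (Real.continuous_rpow_const (by positivity)))
      ((continuous_const.mul continuous_id).add continuous_const)
  have : Ici (0 : ℝ) ⊆ {d : ℝ | c * d ^ (1 / q) ≤ t * d + k} := by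
    rw [← closure_Ioi]
    exact hcl.closure_subset_iff.2 h
  exact this hd

lemma exists_pos_mul_rpow_le {q c e : ℝ} (hq : 0 < q) (hc : 0 ≤ c) (he : 0 < e) :
    ∃ η : ℝ, 0 < η ∧ c * η ^ (1 / q) ≤ e := by
  refine ⟨(e / (c + 1)) ^ q, by positivity, ?_⟩
  rw [← Real.rpow_mul (by positivity), mul_one_div_cancel hq.ne', Real.rpow_one, mul_div_assoc',
    div_le_iff₀ (by positivity)]
  nlinarith

lemma concaveOn_const_mul_rpow {q c : ℝ} (hq : 1 < q) (hc : 0 ≤ c) :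
    ConcaveOn ℝ (Ici 0) fun d : ℝ => c * d ^ (1 / q) :=
  (Real.concaveOn_rpow (by positivity) (by rw [div_le_one (by linarith)]; exact hq.le)).smul hc

lemma rpow_add_le {q x y : ℝ} (hq : 1 < q) (hx : 0 ≤ x) (hy : 0 ≤ y) :
    (x + y) ^ (1 / q) ≤ x ^ (1 / q) + y ^ (1 / q) :=
  Real.rpow_add_le_add_rpow hx hy (by positivity)
    (by rw [div_le_one (by linarith)]; exact hq.le)

lemma map_prod_eq (g : ℝ × ℝ →L[ℝ] ℝ) (x y : ℝ) : g (x, y) = x * g (1, 0) + y * g (0, 1) := by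
  rw [← smul_eq_mul, ← smul_eq_mul, ← map_smul, ← map_smul, ← map_add]
  simp

/-- `S` is to be read as the set of pairs (nominal risk, radius), `t` as `v_{N+1}` and `k` as the
budget of the perspective term. Separation needs an open domain, so `S` is translated by `η` into
positive radii; by subadditivity of the root this costs at most `c * η ^ (1 / q) ≤ s' - s`. -/
lemma affine_duality {q c s s' : ℝ} {S : Set (ℝ × ℝ)} (hq : 1 < q) (hc : 0 ≤ c)
    (hS : Convex ℝ S) (hne : S.Nonempty) (h0 : ∀ x ∈ S, 0 ≤ x.2)
    (hs : ∀ x ∈ S, x.1 + c * x.2 ^ (1 / q) ≤ s) (hss : s < s') :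
    ∃ t k : ℝ, 0 ≤ t ∧ (∀ x ∈ S, x.1 + t * x.2 ≤ s' - k) ∧
      ∀ d : ℝ, 0 ≤ d → c * d ^ (1 / q) ≤ t * d + k := by
  obtain ⟨η, hη, hηs⟩ := exists_pos_mul_rpow_le (q := q) (by linarith) hc (sub_pos.2 hss)
  set U : Set (ℝ × ℝ) := {z | 0 < z.2} with hU
  have hUo : IsOpen U := isOpen_lt continuous_const continuous_snd
  have hUc : Convex ℝ U := (convex_Ioi (0 : ℝ)).linear_preimage (LinearMap.snd ℝ ℝ ℝ)
  have hΦ : ConcaveOn ℝ U fun z : ℝ × ℝ => z.1 + c * z.2 ^ (1 / q) := by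
    refine ((LinearMap.fst ℝ ℝ ℝ).concaveOn hUc).add ?_
    exact ((concaveOn_const_mul_rpow hq hc).comp_linearMap (LinearMap.snd ℝ ℝ ℝ)).subset
      (fun z hz => mem_preimage.2 (mem_Ici.2 (le_of_lt hz))) hUc
  have hΦc : ContinuousOn (fun z : ℝ × ℝ => z.1 + c * z.2 ^ (1 / q)) U :=
    (continuous_fst.add (continuous_const.mul
      ((Real.continuous_rpow_const (by positivity)).comp continuous_snd))).continuousOn
  obtain ⟨g, hg⟩ := exists_linear_of_concave_le (S := (fun z => (0, η) + z) '' S) (M := s')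
    (hS.translate (0, η)) (hne.image _) (by
      rintro _ ⟨x, hx, rfl⟩
      have := h0 x hx
      simp only [hU, mem_ofPred_eq, Prod.snd_add]
      exact add_pos_of_pos_of_nonneg hη this) hUo hΦ hΦc (by
      rintro _ ⟨x, hx, rfl⟩
      have e1 := hs x hx
      have e2 := mul_le_mul_of_nonneg_left (rpow_add_le hq (h0 x hx) hη.le) hc
      simp only [Prod.fst_add, Prod.snd_add, zero_add]
      rw [add_comm η]
      linarith)
  set t := g (0, 1) with ht
  have hg' : ∀ x ∈ S, ∀ a d : ℝ, 0 < d →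
      (x.1 * g (1, 0) + (x.2 + η) * t) + (a + c * d ^ (1 / q) - (a * g (1, 0) + d * t)) ≤ s' := by
    intro x hx a d hd
    have := hg _ ⟨x, hx, rfl⟩ (a, d) hd
    rw [map_prod_eq g a d, show (fun z : ℝ × ℝ => (0, η) + z) x = (x.1, x.2 + η) by
      ext <;> simp [add_comm], map_prod_eq] at this
    exact this
  -- The bound holds for every real `a` and is affine in it, so the coefficient `1 - g (1, 0)`
  -- vanishes; otherwise the `a` chosen below would give `s' + 1 ≤ s'`.
  have hg1 : g (1, 0) = 1 := by
    obtain ⟨x, hx⟩ := hne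
    set w := (x.1 * g (1, 0) + (x.2 + η) * t) + (c * 1 ^ (1 / q) - 1 * t) with hw
    by_contra hn
    have hn' : 1 - g (1, 0) ≠ 0 := fun h => hn (by linarith)
    have h1 := hg' x hx ((s' - w + 1) / (1 - g (1, 0))) 1 one_pos
    have h2 : (s' - w + 1) / (1 - g (1, 0)) * (1 - g (1, 0)) = s' - w + 1 :=
      div_mul_cancel₀ _ hn'
    linarith
  obtain ⟨k', hk1, hk2⟩ := exists_split_bound (A := S) (B := Ioi (0 : ℝ)) hne ⟨1, mem_Ioi.2 one_pos⟩
    (f := fun x => x.1 + (x.2 + η) * t) (g := fun d => c * d ^ (1 / q) - d * t) (K := s') (by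
      intro x hx d hd
      have := hg' x hx 0 d hd
      rw [hg1] at this
      linarith)
  have hd : ∀ d : ℝ, 0 < d → c * d ^ (1 / q) ≤ t * d + (s' - k') := by
    intro d hd
    linarith [hk2 d hd]
  have ht0 : 0 ≤ t := nonneg_of_forall_rpow_le hc hd
  refine ⟨t, s' - k', ht0, fun x hx => ?_, forall_nonneg_rpow_le (by linarith) hd⟩
  have := hk1 x hx
  nlinarith [mul_nonneg hη.le ht0]

/-- Now the risk also enters through a root, so it receives its own multiplier `τ` and its own Young
term with budget `constOne q * y`. The condition `1 ≤ τ * y ^ (q - 1)` is what makes `v_i = τ * ℓ_i`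
feasible for the quotient constraint. -/
lemma power_duality {q c s s' : ℝ} {S : Set (ℝ × ℝ)} (hq : 1 < q) (hc : 0 ≤ c)
    (hS : Convex ℝ S) (hne : S.Nonempty) (h01 : ∀ x ∈ S, 0 ≤ x.1) (h02 : ∀ x ∈ S, 0 ≤ x.2)
    (hs : ∀ x ∈ S, x.1 ^ (1 / q) + c * x.2 ^ (1 / q) ≤ s) (hss : s < s') :
    ∃ τ t y k : ℝ, 0 ≤ τ ∧ 0 ≤ t ∧ 0 ≤ y ∧ 1 ≤ τ * y ^ (q - 1) ∧
      (∀ x ∈ S, τ * x.1 + t * x.2 + constOne q * y ≤ s' - k) ∧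
      ∀ d : ℝ, 0 ≤ d → c * d ^ (1 / q) ≤ t * d + k := by
  obtain ⟨η, hη, hηs⟩ := exists_pos_mul_rpow_le (q := q) (c := 1 + c) (by linarith) (by linarith)
    (sub_pos.2 hss)
  set U : Set (ℝ × ℝ) := {z | 0 < z.1} ∩ {z | 0 < z.2} with hU
  have hUo : IsOpen U := (isOpen_lt continuous_const continuous_fst).inter
    (isOpen_lt continuous_const continuous_snd)
  have hUc : Convex ℝ U := ((convex_Ioi (0 : ℝ)).linear_preimage (LinearMap.fst ℝ ℝ ℝ)).inter
    ((convex_Ioi (0 : ℝ)).linear_preimage (LinearMap.snd ℝ ℝ ℝ))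
  have hΦ : ConcaveOn ℝ U fun z : ℝ × ℝ => 1 * z.1 ^ (1 / q) + c * z.2 ^ (1 / q) :=
    (((concaveOn_const_mul_rpow hq zero_le_one).comp_linearMap (LinearMap.fst ℝ ℝ ℝ)).subset
      (fun z hz => mem_preimage.2 (mem_Ici.2 (le_of_lt hz.1))) hUc).add
      (((concaveOn_const_mul_rpow hq hc).comp_linearMap (LinearMap.snd ℝ ℝ ℝ)).subset
      (fun z hz => mem_preimage.2 (mem_Ici.2 (le_of_lt hz.2))) hUc)
  have hΦc : ContinuousOn (fun z : ℝ × ℝ => 1 * z.1 ^ (1 / q) + c * z.2 ^ (1 / q)) U :=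
    ((continuous_const.mul
      ((Real.continuous_rpow_const (by positivity)).comp continuous_fst)).add (continuous_const.mul
      ((Real.continuous_rpow_const (by positivity)).comp continuous_snd))).continuousOn
  obtain ⟨g, hg⟩ := exists_linear_of_concave_le (S := (fun z => (η, η) + z) '' S) (M := s')
    (hS.translate (η, η)) (hne.image _) (by
      rintro _ ⟨x, hx, rfl⟩
      have e1 := h01 x hx
      have e2 := h02 x hx
      simp only [hU, mem_inter_iff, mem_ofPred_eq, Prod.fst_add, Prod.snd_add]
      exact ⟨by linarith, by linarith⟩) hUo hΦ hΦc (by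
      rintro _ ⟨x, hx, rfl⟩
      have e1 := hs x hx
      have e2 := mul_le_mul_of_nonneg_left (rpow_add_le hq (h02 x hx) hη.le) hc
      have e3 := rpow_add_le hq (h01 x hx) hη.le
      simp only [Prod.fst_add, Prod.snd_add]
      rw [add_comm η, add_comm η]
      linarith)
  set t := g (0, 1) with ht
  set τ := g (1, 0) with hτ
  have hg' : ∀ x ∈ S, ∀ a d : ℝ, 0 < a → 0 < d →
      ((x.1 + η) * τ + (x.2 + η) * t) +
        (1 * a ^ (1 / q) + c * d ^ (1 / q) - (a * τ + d * t)) ≤ s' := by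
    intro x hx a d ha hd
    have := hg _ ⟨x, hx, rfl⟩ (a, d) ⟨ha, hd⟩
    rw [map_prod_eq g a d, show (fun z : ℝ × ℝ => (η, η) + z) x = (x.1 + η, x.2 + η) by
      ext <;> simp [add_comm], map_prod_eq] at this
    exact this
  -- Two successive splits: this one detaches the radius variable `d`, the next one the risk
  -- variable `a` from the points of `S`.
  obtain ⟨k', hk1, hk2⟩ := exists_split_bound (A := S ×ˢ Ioi (0 : ℝ)) (B := Ioi (0 : ℝ))
    (hne.prod ⟨1, mem_Ioi.2 one_pos⟩) ⟨1, mem_Ioi.2 one_pos⟩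
    (f := fun z => ((z.1.1 + η) * τ + (z.1.2 + η) * t) + (1 * z.2 ^ (1 / q) - z.2 * τ))
    (g := fun d => c * d ^ (1 / q) - d * t) (K := s') (by
      rintro ⟨x, a⟩ ⟨hx, ha⟩ d hd
      have := hg' x hx a d ha hd
      simp only
      linarith)
  obtain ⟨k₁, hk3, hk4⟩ := exists_split_bound (A := S) (B := Ioi (0 : ℝ)) hne ⟨1, mem_Ioi.2 one_pos⟩
    (f := fun x => (x.1 + η) * τ + (x.2 + η) * t) (g := fun a => 1 * a ^ (1 / q) - a * τ)
    (K := k') (fun x hx a ha => hk1 (x, a) ⟨hx, ha⟩)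
  have hd : ∀ d : ℝ, 0 < d → c * d ^ (1 / q) ≤ t * d + (s' - k') := by
    intro d hd
    linarith [hk2 d hd]
  have ha : ∀ a : ℝ, 0 < a → 1 * a ^ (1 / q) ≤ τ * a + (k' - k₁) := by
    intro a ha
    linarith [hk4 a ha]
  have ht0 : 0 ≤ t := nonneg_of_forall_rpow_le hc hd
  have hτ0 : 0 ≤ τ := nonneg_of_forall_rpow_le zero_le_one ha
  have ha' := forall_nonneg_rpow_le (by linarith) ha
  have hkk : 0 ≤ k' - k₁ := by
    have := ha' 0 le_rfl
    rwa [Real.zero_rpow (by positivity), mul_zero, mul_zero, zero_add] at this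
  have hC1 := constOne_pos hq
  have hy : constOne q * ((k' - k₁) / constOne q) = k' - k₁ := by field_simp
  refine ⟨τ, t, (k' - k₁) / constOne q, s' - k', hτ0, ht0, by positivity, ?_, fun x hx => ?_,
    forall_nonneg_rpow_le (by linarith) hd⟩
  · have := (young_iff (a := 1) (y := (k' - k₁) / constOne q) hq zero_le_one hτ0
      (by positivity)).1 (by rwa [hy])
    rwa [Real.one_rpow] at this
  · rw [hy]
    have := hk3 x hx
    nlinarith [mul_nonneg hη.le ht0, mul_nonneg hη.le hτ0]

/-! ### Pairing, norm and Lipschitz-constant preliminaries -/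

section Programs

variable {E : Type*} [NormedAddCommGroup E] [NormedSpace ℝ E] {N : ℕ}

lemma pairing_mono {v w x : (Fin N → ℝ) × ℝ} (hx : ∀ i, 0 ≤ x.1 i) (hx2 : 0 ≤ x.2)
    (h1 : ∀ i, v.1 i ≤ w.1 i) (h2 : v.2 ≤ w.2) : pairing v x ≤ pairing w x :=
  add_le_add (Finset.sum_le_sum fun i _ => mul_le_mul_of_nonneg_right (h1 i) (hx i))
    (mul_le_mul_of_nonneg_right h2 hx2)

lemma pairing_combo (a b : ℝ) (v w x : (Fin N → ℝ) × ℝ) :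
    pairing (a • v + b • w) x = a * pairing v x + b * pairing w x := by
  simp only [pairing, Prod.fst_add, Prod.snd_add, Prod.smul_fst, Prod.smul_snd, Pi.add_apply,
    Pi.smul_apply, smul_eq_mul, mul_add, Finset.mul_sum, add_mul, Finset.sum_add_distrib, mul_assoc]
  ring

lemma norm_combo_le {X : Type*} [SeminormedAddCommGroup X] [NormedSpace ℝ X] {a b : ℝ}
    (ha : 0 ≤ a) (hb : 0 ≤ b) (x y : X) : ‖a • x + b • y‖ ≤ a * ‖x‖ + b * ‖y‖ := by
  simpa [norm_smul, abs_of_nonneg, ha, hb] using norm_add_le (a • x) (b • y)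

lemma convex_nonnegPart {V : Set ((Fin N → ℝ) × ℝ)} (hV : Convex ℝ V) :
    Convex ℝ (nonnegPart V) := by
  intro x hx y hy a b ha hb hab
  refine ⟨hV hx.1 hy.1 ha hb hab, ?_⟩
  have h1 := hx.2
  have h2 := hy.2
  simp only [Prod.snd_add, Prod.smul_snd, smul_eq_mul]
  positivity

lemma lipConst_nonneg (ℓ : ℝ → ℝ) : 0 ≤ lipConst ℓ := Real.sInf_nonneg fun _ h => h.1

/-- The infimum is attained: each difference quotient bounds all admissible constants from below.
The hypothesis excludes the empty set, whose `sInf` is `0`. -/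
lemma abs_sub_le_lipConst {ℓ : ℝ → ℝ} (h : ∃ K : ℝ≥0, LipschitzWith K ℓ) (x y : ℝ) :
    |ℓ x - ℓ y| ≤ lipConst ℓ * |x - y| := by
  obtain ⟨K, hK⟩ := h
  rcases eq_or_lt_of_le (abs_nonneg (x - y)) with h0 | h0
  · rw [← h0, mul_zero]
    have : x = y := sub_eq_zero.1 (abs_eq_zero.1 h0.symm)
    simp [this]
  · rw [← div_le_iff₀ h0]
    refine le_csInf ⟨K, K.2, fun x y => ?_⟩ fun b hb => ?_
    · simpa [Real.dist_eq] using hK.dist_le_mul x y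
    · rw [div_le_iff₀ h0]
      exact hb.2 x y

/-! ### The Lipschitz program -/

lemma robustLipschitz_le_iff {yhat : Fin N → E} {V : Set ((Fin N → ℝ) × ℝ)} {ℓ : ℝ → ℝ}
    {α : StrongDual ℝ E} {s : ℝ} :
    robustLipschitz yhat V ℓ α ≤ (s : EReal) ↔
      ∀ x ∈ nonnegPart V, ∑ i, x.1 i * ℓ (α (yhat i)) + lipConst ℓ * x.2 * ‖α‖ ≤ s := by
  simp only [robustLipschitz, iSup_le_iff, EReal.coe_le_coe_iff]

/-- Since `p` and `δ` are nonnegative on `V₊`, `σ*` increases with `v`, so the best `v` makes every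
constraint tight. -/
lemma solvedBy_lipschitz {yhat : Fin N → E} {V : Set ((Fin N → ℝ) × ℝ)}
    (hVp : ∀ x ∈ V, (∀ i, 0 ≤ x.1 i) ∧ ∑ i, x.1 i = 1) (A : Set (StrongDual ℝ E)) (ℓ : ℝ → ℝ) :
    SolvedBy A (robustLipschitz yhat V ℓ) (feasibleLipschitz A yhat ℓ) (objLipschitz V) := by
  have hpair : ∀ (α : StrongDual ℝ E) (x : (Fin N → ℝ) × ℝ),
      pairing (fun i => ℓ (α (yhat i)), lipConst ℓ * ‖α‖) x =
        ∑ i, x.1 i * ℓ (α (yhat i)) + lipConst ℓ * x.2 * ‖α‖ := by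
    intro α x
    simp only [pairing, mul_comm (x.1 _)]
    ring
  refine SolvedBy.of_forall_coe (fun z hz => hz.1) (fun z hz s hs => ?_) fun α hα s s' hs hss => ?_
  · rw [robustLipschitz_le_iff]
    intro x hx
    rw [← hpair]
    exact (pairing_mono (hVp x hx.1).1 hx.2 hz.2.1 hz.2.2).trans (sigmaStar_le_iff.1 hs x hx)
  · refine ⟨(fun i => ℓ (α (yhat i)), lipConst ℓ * ‖α‖), ⟨hα, fun i => le_rfl, le_rfl⟩, ?_⟩
    refine sigmaStar_le_iff.2 fun x hx => ?_
    rw [hpair]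
    exact (robustLipschitz_le_iff.1 hs x hx).trans hss.le

lemma convexOn_comp_apply_le {ℓ : ℝ → ℝ} (hℓ : ConvexOn ℝ univ ℓ) {a b : ℝ} (ha : 0 ≤ a)
    (hb : 0 ≤ b) (hab : a + b = 1) (α β : StrongDual ℝ E) (y : E) :
    ℓ ((a • α + b • β) y) ≤ a * ℓ (α y) + b * ℓ (β y) := by
  simpa using hℓ.2 (mem_univ (α y)) (mem_univ (β y)) ha hb hab

lemma isConvexProgram_lipschitz (yhat : Fin N → E) (V : Set ((Fin N → ℝ) × ℝ))
    {A : Set (StrongDual ℝ E)} (hA : Convex ℝ A) {ℓ : ℝ → ℝ} (hℓ : ConvexOn ℝ univ ℓ) :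
    IsConvexProgram (feasibleLipschitz A yhat ℓ) (objLipschitz V) := by
  have hK : Convex ℝ (feasibleLipschitz A yhat ℓ) := by
    rintro z ⟨hz1, hz2, hz3⟩ w ⟨hw1, hw2, hw3⟩ a b ha hb hab
    refine ⟨hA hz1 hw1 ha hb hab, fun i => ?_, ?_⟩
    · refine (convexOn_comp_apply_le hℓ ha hb hab z.1 w.1 (yhat i)).trans ?_
      exact add_le_add (mul_le_mul_of_nonneg_left (hz2 i) ha)
        (mul_le_mul_of_nonneg_left (hw2 i) hb)
    · have e1 := mul_le_mul_of_nonneg_left (norm_combo_le ha hb z.1 w.1) (lipConst_nonneg ℓ)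
      have e2 := mul_le_mul_of_nonneg_left hz3 ha
      have e3 := mul_le_mul_of_nonneg_left hw3 hb
      simp only [Prod.fst_add, Prod.snd_add, Prod.smul_fst, Prod.smul_snd, smul_eq_mul]
      linarith
  refine ⟨hK, ?_⟩
  rintro ⟨z, s⟩ ⟨hz, hs⟩ ⟨w, s'⟩ ⟨hw, hs'⟩ a b ha hb hab
  refine ⟨hK hz hw ha hb hab, sigmaStar_le_iff.2 fun x hx => ?_⟩
  simp only [Prod.fst_add, Prod.snd_add, Prod.smul_fst, Prod.smul_snd, smul_eq_mul]
  rw [pairing_combo]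
  exact add_le_add (mul_le_mul_of_nonneg_left (sigmaStar_le_iff.1 hs x hx) ha)
    (mul_le_mul_of_nonneg_left (sigmaStar_le_iff.1 hs' x hx) hb)

/-! ### The affine program -/

lemma robustAffine_le_iff {q C : ℝ} {yhat : Fin N → E} {V : Set ((Fin N → ℝ) × ℝ)} {ℓ : ℝ → ℝ}
    {α : StrongDual ℝ E} {s : ℝ} :
    robustAffine q C yhat V ℓ α ≤ (s : EReal) ↔
      ∀ x ∈ nonnegPart V, ∑ i, x.1 i * ℓ (α (yhat i)) + C * x.2 ^ (1 / q) * ‖α‖ ≤ s := by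
  simp only [robustAffine, iSup_le_iff, EReal.coe_le_coe_iff]

lemma constTwo_mul_perspective_ne_bot {X : Type*} [NormedAddCommGroup X] [NormedSpace ℝ X]
    {q C r t : ℝ} {α : X} (hq : 1 < q) (hC : 0 < C) (ht : 0 ≤ t) :
    (constTwo q C : EReal) * perspective r t α ≠ ⊥ :=
  ne_bot_of_le_ne_bot (by simp) (mul_nonneg (EReal.coe_nonneg.2 (constTwo_pos hq hC).le)
    (perspective_nonneg ht))

/-- The epigraph becomes a family of inequalities jointly convex in all variables, from which both
duality and convexity are read off. -/
lemma objAffine_le_iff {q C s : ℝ} {V : Set ((Fin N → ℝ) × ℝ)} (hne : (nonnegPart V).Nonempty)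
    {z : StrongDual ℝ E × ((Fin N → ℝ) × ℝ)} (hq : 1 < q) (hC : 0 < C) (hz : 0 ≤ z.2.2) :
    objAffine q C V z ≤ (s : EReal) ↔ ∃ c₁ c₂ : ℝ, (∀ x ∈ nonnegPart V, pairing z.2 x ≤ c₁) ∧
      (∀ d : ℝ, 0 ≤ d → C * ‖z.1‖ * d ^ (1 / q) ≤ z.2.2 * d + c₂) ∧ c₁ + c₂ ≤ s := by
  rw [objAffine, add_le_coe_iff (sigmaStar_ne_bot hne _)
    (constTwo_mul_perspective_ne_bot hq hC hz)]
  simp only [sigmaStar_le_iff, constTwo_mul_perspective_le_iff hq hC hz]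

lemma perspective_bound_combo {q C a b t t' c c' : ℝ} (hC : 0 < C) (ha : 0 ≤ a) (hb : 0 ≤ b)
    {α β : StrongDual ℝ E}
    (h : ∀ d : ℝ, 0 ≤ d → C * ‖α‖ * d ^ (1 / q) ≤ t * d + c)
    (h' : ∀ d : ℝ, 0 ≤ d → C * ‖β‖ * d ^ (1 / q) ≤ t' * d + c') (d : ℝ) (hd : 0 ≤ d) :
    C * ‖a • α + b • β‖ * d ^ (1 / q) ≤ (a * t + b * t') * d + (a * c + b * c') := by
  have e1 := mul_le_mul_of_nonneg_left (h d hd) ha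
  have e2 := mul_le_mul_of_nonneg_left (h' d hd) hb
  have e3 : C * ‖a • α + b • β‖ * d ^ (1 / q) ≤ C * (a * ‖α‖ + b * ‖β‖) * d ^ (1 / q) :=
    mul_le_mul_of_nonneg_right (mul_le_mul_of_nonneg_left (norm_combo_le ha hb α β) hC.le)
      (by positivity)
  linarith

/-- For fixed losses the risk is linear in `p`, which reduces duality over `V₊` to a convex set in
the plane. -/
lemma convex_image_risk {S : Set ((Fin N → ℝ) × ℝ)} (hS : Convex ℝ S) (L : Fin N → ℝ) :
    Convex ℝ ((fun x : (Fin N → ℝ) × ℝ => (∑ i, x.1 i * L i, x.2)) '' S) := by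
  refine hS.is_linear_image (f := fun x : (Fin N → ℝ) × ℝ => (∑ i, x.1 i * L i, x.2)) ⟨?_, ?_⟩
  · intro x y
    simp [add_mul, Finset.sum_add_distrib]
  · intro c x
    simp [Finset.mul_sum, mul_assoc]

lemma solvedBy_affine {q C : ℝ} (hq : 1 < q) (hC : 0 < C) {yhat : Fin N → E}
    {V : Set ((Fin N → ℝ) × ℝ)} (hV : Convex ℝ V)
    (hVp : ∀ x ∈ V, (∀ i, 0 ≤ x.1 i) ∧ ∑ i, x.1 i = 1) (hne : (nonnegPart V).Nonempty)
    (A : Set (StrongDual ℝ E)) (ℓ : ℝ → ℝ) :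
    SolvedBy A (robustAffine q C yhat V ℓ) (feasibleAffine A yhat ℓ) (objAffine q C V) := by
  refine SolvedBy.of_forall_coe (fun z hz => hz.1) (fun z hz s hs => ?_) fun α hα s s' hs hss => ?_
  · rw [robustAffine_le_iff]
    intro x hx
    obtain ⟨c₁, c₂, h1, h2, h3⟩ := (objAffine_le_iff hne hq hC hz.2.2).1 hs
    have e1 := h1 x hx
    -- Weak duality: the bound for all `d` is used at the radius itself.
    have e2 := h2 x.2 hx.2
    have e3 : ∑ i, x.1 i * ℓ (z.1 (yhat i)) ≤ ∑ i, z.2.1 i * x.1 i := by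
      refine Finset.sum_le_sum fun i _ => ?_
      rw [mul_comm]
      exact mul_le_mul_of_nonneg_right (hz.2.1 i) ((hVp x hx.1).1 i)
    unfold pairing at e1
    linarith
  · obtain ⟨t, k, ht, h1, h2⟩ := affine_duality (c := C * ‖α‖) (s := s) (s' := s') hq (by positivity)
      (convex_image_risk (convex_nonnegPart hV) fun i => ℓ (α (yhat i))) (hne.image _)
      (by rintro _ ⟨x, hx, rfl⟩; exact hx.2) (by
        rintro _ ⟨x, hx, rfl⟩
        have := robustAffine_le_iff.1 hs x hx
        simp only
        linarith) hss
    refine ⟨(fun i => ℓ (α (yhat i)), t), ⟨hα, fun i => le_rfl, ht⟩,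
      (objAffine_le_iff hne hq hC ht).2 ⟨s' - k, k, fun x hx => ?_, h2, by linarith⟩⟩
    have := h1 _ ⟨x, hx, rfl⟩
    simpa only [pairing, mul_comm (x.1 _)] using this

lemma isConvexProgram_affine {q C : ℝ} (hq : 1 < q) (hC : 0 < C) (yhat : Fin N → E)
    {V : Set ((Fin N → ℝ) × ℝ)} (hne : (nonnegPart V).Nonempty)
    {A : Set (StrongDual ℝ E)} (hA : Convex ℝ A) {ℓ : ℝ → ℝ} (hℓ : ConvexOn ℝ univ ℓ) :
    IsConvexProgram (feasibleAffine A yhat ℓ) (objAffine q C V) := by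
  have hK : Convex ℝ (feasibleAffine A yhat ℓ) := by
    rintro z ⟨hz1, hz2, hz3⟩ w ⟨hw1, hw2, hw3⟩ a b ha hb hab
    refine ⟨hA hz1 hw1 ha hb hab, fun i => ?_, ?_⟩
    · refine (convexOn_comp_apply_le hℓ ha hb hab z.1 w.1 (yhat i)).trans ?_
      exact add_le_add (mul_le_mul_of_nonneg_left (hz2 i) ha)
        (mul_le_mul_of_nonneg_left (hw2 i) hb)
    · exact add_nonneg (mul_nonneg ha hz3) (mul_nonneg hb hw3)
  refine ⟨hK, ?_⟩
  rintro ⟨z, s⟩ ⟨hz, hs⟩ ⟨w, s'⟩ ⟨hw, hs'⟩ a b ha hb hab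
  have hzw := hK hz hw ha hb hab
  refine ⟨hzw, ?_⟩
  obtain ⟨c₁, c₂, h1, h2, h3⟩ := (objAffine_le_iff hne hq hC hz.2.2).1 hs
  obtain ⟨c₁', c₂', h1', h2', h3'⟩ := (objAffine_le_iff hne hq hC hw.2.2).1 hs'
  refine (objAffine_le_iff hne hq hC hzw.2.2).2 ⟨a * c₁ + b * c₁', a * c₂ + b * c₂',
    fun x hx => ?_, perspective_bound_combo hC ha hb h2 h2', ?_⟩
  · have := add_le_add (mul_le_mul_of_nonneg_left (h1 x hx) ha)
      (mul_le_mul_of_nonneg_left (h1' x hx) hb)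
    rwa [← pairing_combo] at this
  · have e1 := mul_le_mul_of_nonneg_left h3 ha
    have e2 := mul_le_mul_of_nonneg_left h3' hb
    simp only [Prod.snd_add, Prod.smul_snd, smul_eq_mul] at *
    linarith

/-! ### The power program -/

lemma robustPower_le_iff {q C : ℝ} {yhat : Fin N → E} {V : Set ((Fin N → ℝ) × ℝ)} {ℓ : ℝ → ℝ}
    {α : StrongDual ℝ E} {s : ℝ} :
    robustPower q C yhat V ℓ α ≤ (s : EReal) ↔
      ∀ x ∈ nonnegPart V, ((∑ i, x.1 i * ℓ (α (yhat i))) ^ (1 / q) + C * x.2 ^ (1 / q) * ‖α‖) ^ q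
        ≤ s := by
  simp only [robustPower, iSup_le_iff, EReal.coe_le_coe_iff]

/-- Undoing the outer power puts the concave function `s ^ (1 / q)` on the right, so the epigraph
stays convex. -/
lemma objPower_le_iff {q C s : ℝ} {V : Set ((Fin N → ℝ) × ℝ)} (hne : (nonnegPart V).Nonempty)
    {z : StrongDual ℝ E × (((Fin N → ℝ) × ℝ) × ℝ)} (hq : 1 < q) (hC : 0 < C)
    (hz : 0 ≤ z.2.1.2) :
    objPower q C V z ≤ (s : EReal) ↔ 0 ≤ s ∧ ∃ c₁ c₂ : ℝ,
      (∀ x ∈ nonnegPart V, pairing z.2.1 x ≤ c₁) ∧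
      (∀ d : ℝ, 0 ≤ d → C * ‖z.1‖ * d ^ (1 / q) ≤ z.2.1.2 * d + c₂) ∧
      c₁ + constOne q * z.2.2 + c₂ ≤ s ^ (1 / q) := by
  have h1 := sigmaStar_ne_bot hne z.2.1
  rw [objPower, epow_le_iff (by linarith), add_le_coe_iff
    (EReal.add_ne_bot_iff.2 ⟨h1, EReal.coe_ne_bot _⟩) (constTwo_mul_perspective_ne_bot hq hC hz)]
  simp only [constTwo_mul_perspective_le_iff hq hC hz]
  refine and_congr_right fun _ => ⟨?_, ?_⟩
  · rintro ⟨c₁, c₂, h2, h3, h4⟩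
    obtain ⟨c₃, c₄, h5, h6, h7⟩ := (add_le_coe_iff h1 (EReal.coe_ne_bot _)).1 h2
    rw [EReal.coe_le_coe_iff] at h6
    exact ⟨c₃, c₂, sigmaStar_le_iff.1 h5, h3, by linarith⟩
  · rintro ⟨c₁, c₂, h2, h3, h4⟩
    exact ⟨c₁ + constOne q * z.2.2, c₂, (add_le_coe_iff h1 (EReal.coe_ne_bot _)).2
      ⟨c₁, _, sigmaStar_le_iff.2 h2, le_rfl, le_rfl⟩, h3, h4⟩

/-- Young's inequality turns the quotient constraint into conditions linear in `f`, `v` and `y`, so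
convexity of `f` suffices for a convex feasible set. -/
lemma mem_feasiblePower_iff {q : ℝ} (hq : 1 < q) {A : Set (StrongDual ℝ E)} {yhat : Fin N → E}
    {f : ℝ → ℝ} (hf : ∀ x, 0 ≤ f x) {z : StrongDual ℝ E × (((Fin N → ℝ) × ℝ) × ℝ)} :
    z ∈ feasiblePower q A yhat (fun x => f x ^ q) ↔ z.1 ∈ A ∧ 0 ≤ z.2.2 ∧
      (∀ i, 0 ≤ z.2.1.1 i ∧ ∀ d : ℝ, 0 ≤ d →
        f (z.1 (yhat i)) * d ^ (1 / q) ≤ z.2.1.1 i * d + constOne q * z.2.2) ∧ 0 ≤ z.2.1.2 := by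
  unfold feasiblePower
  refine and_congr_right fun _ => and_congr_right fun hy => and_congr_left fun _ =>
    forall_congr' fun i => ?_
  rw [quotient_le_iff (Real.rpow_nonneg (hf _) _) hy]
  exact and_congr_right fun hv => (young_iff hq (hf _) hv hy).symm

lemma solvedBy_power {q C : ℝ} (hq : 1 < q) (hC : 0 < C) {yhat : Fin N → E}
    {V : Set ((Fin N → ℝ) × ℝ)} (hV : Convex ℝ V)
    (hVp : ∀ x ∈ V, (∀ i, 0 ≤ x.1 i) ∧ ∑ i, x.1 i = 1) (hne : (nonnegPart V).Nonempty)
    (A : Set (StrongDual ℝ E)) {f : ℝ → ℝ} (hf : ∀ x, 0 ≤ f x) :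
    SolvedBy A (robustPower q C yhat V fun x => f x ^ q)
      (feasiblePower q A yhat fun x => f x ^ q) (objPower q C V) := by
  have h0 : 0 < q := by linarith
  have hrisk : ∀ x ∈ nonnegPart V, ∀ α : StrongDual ℝ E,
      0 ≤ ∑ i, x.1 i * f (α (yhat i)) ^ q := fun x hx α =>
    Finset.sum_nonneg fun i _ => mul_nonneg ((hVp x hx.1).1 i) (Real.rpow_nonneg (hf _) _)
  refine SolvedBy.of_forall_coe (fun z hz => hz.1) (fun z hz s hs => ?_) fun α hα s s' hs hss => ?_
  · rw [robustPower_le_iff]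
    intro x hx
    obtain ⟨hs0, c₁, c₂, h1, h2, h3⟩ := (objPower_le_iff hne hq hC hz.2.2.2).1 hs
    have e1 := h1 x hx
    have e2 := h2 x.2 hx.2
    have hL := hrisk x hx z.1
    have hx2 := hx.2
    have hz1 : ∀ i, 0 ≤ z.2.1.1 i ∧ f (z.1 (yhat i)) ^ q ≤ z.2.1.1 i * z.2.2 ^ (q - 1) :=
      fun i => (quotient_le_iff (Real.rpow_nonneg (hf _) _) hz.2.1).1 (hz.2.2.1 i)
    have hP : 0 ≤ ∑ i, z.2.1.1 i * x.1 i :=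
      Finset.sum_nonneg fun i _ => mul_nonneg (hz1 i).1 ((hVp x hx.1).1 i)
    have e3 : ∑ i, x.1 i * f (z.1 (yhat i)) ^ q ≤
        (∑ i, z.2.1.1 i * x.1 i) * z.2.2 ^ (q - 1) := by
      rw [Finset.sum_mul]
      refine Finset.sum_le_sum fun i _ => ?_
      have := mul_le_mul_of_nonneg_left (hz1 i).2 ((hVp x hx.1).1 i)
      linarith
    have e4 : ((∑ i, x.1 i * f (z.1 (yhat i)) ^ q) ^ (1 / q)) ^ q =
        ∑ i, x.1 i * f (z.1 (yhat i)) ^ q := by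
      rw [← Real.rpow_mul hL, one_div_mul_cancel h0.ne', Real.rpow_one]
    -- At `d = 1`, with `a` the `q`-th root of the risk, Young's inequality bounds that root by `∑
    -- v_i p_i + constOne q * y`.
    have e5 := (young_iff hq (by positivity) hP hz.2.1).2 (e4.le.trans e3) 1 zero_le_one
    rw [Real.one_rpow] at e5
    unfold pairing at e1
    have e6 : (∑ i, x.1 i * f (z.1 (yhat i)) ^ q) ^ (1 / q) + C * x.2 ^ (1 / q) * ‖z.1‖ ≤
        s ^ (1 / q) := by linarith
    have e7 := Real.rpow_le_rpow (by positivity) e6 h0.le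
    rwa [← Real.rpow_mul hs0, one_div_mul_cancel h0.ne', Real.rpow_one] at e7
  · have hs0 : 0 ≤ s := by
      obtain ⟨x, hx⟩ := hne
      have := hrisk x hx α
      have hx2 := hx.2
      exact le_trans (by positivity) (robustPower_le_iff.1 hs x hx)
    obtain ⟨τ, t, y, k, hτ, ht, hy, hτy, h1, h2⟩ := power_duality (c := C * ‖α‖)
      (s := s ^ (1 / q)) (s' := s' ^ (1 / q)) hq (by positivity)
      (convex_image_risk (convex_nonnegPart hV) fun i => f (α (yhat i)) ^ q) (hne.image _)
      (by rintro _ ⟨x, hx, rfl⟩; exact hrisk x hx α)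
      (by rintro _ ⟨x, hx, rfl⟩; exact hx.2) (by
        rintro _ ⟨x, hx, rfl⟩
        have e1 := robustPower_le_iff.1 hs x hx
        have e2 := hrisk x hx α
        have hx2 := hx.2
        have e3 := Real.rpow_le_rpow (by positivity) e1 (z := 1 / q) (by positivity)
        rw [← Real.rpow_mul (by positivity), mul_one_div_cancel h0.ne', Real.rpow_one] at e3
        simp only
        linarith) (Real.rpow_lt_rpow hs0 hss (by positivity))
    refine ⟨((fun i => τ * f (α (yhat i)) ^ q, t), y), ⟨hα, hy, fun i => ?_, ht⟩,
      (objPower_le_iff hne hq hC ht).2 ⟨hs0.trans hss.le,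
        s' ^ (1 / q) - k - constOne q * y, k, fun x hx => ?_, h2, by linarith⟩⟩
    · have hfq : 0 ≤ f (α (yhat i)) ^ q := Real.rpow_nonneg (hf _) _
      refine (quotient_le_iff hfq hy).2 ⟨mul_nonneg hτ hfq, ?_⟩
      have := mul_le_mul_of_nonneg_right hτy hfq
      linarith
    · have e1 := h1 _ ⟨x, hx, rfl⟩
      have e2 : ∑ i, τ * f (α (yhat i)) ^ q * x.1 i = τ * ∑ i, x.1 i * f (α (yhat i)) ^ q := by
        rw [Finset.mul_sum]
        exact Finset.sum_congr rfl fun i _ => by ring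
      simp only [pairing, e2]
      simp only at e1
      linarith

lemma isConvexProgram_power {q C : ℝ} (hq : 1 < q) (hC : 0 < C) (yhat : Fin N → E)
    {V : Set ((Fin N → ℝ) × ℝ)} (hne : (nonnegPart V).Nonempty)
    {A : Set (StrongDual ℝ E)} (hA : Convex ℝ A) {f : ℝ → ℝ} (hf : ∀ x, 0 ≤ f x)
    (hfc : ConvexOn ℝ univ f) :
    IsConvexProgram (feasiblePower q A yhat fun x => f x ^ q) (objPower q C V) := by
  have hK : Convex ℝ (feasiblePower q A yhat fun x => f x ^ q) := by
    intro z hz w hw a b ha hb hab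
    rw [mem_feasiblePower_iff hq hf] at *
    obtain ⟨hz1, hz2, hz3, hz4⟩ := hz
    obtain ⟨hw1, hw2, hw3, hw4⟩ := hw
    refine ⟨hA hz1 hw1 ha hb hab, add_nonneg (mul_nonneg ha hz2) (mul_nonneg hb hw2),
      fun i => ⟨add_nonneg (mul_nonneg ha (hz3 i).1) (mul_nonneg hb (hw3 i).1), fun d hd => ?_⟩,
      add_nonneg (mul_nonneg ha hz4) (mul_nonneg hb hw4)⟩
    have e1 := mul_le_mul_of_nonneg_right
      (convexOn_comp_apply_le hfc ha hb hab z.1 w.1 (yhat i)) (Real.rpow_nonneg hd (1 / q))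
    have e2 := mul_le_mul_of_nonneg_left ((hz3 i).2 d hd) ha
    have e3 := mul_le_mul_of_nonneg_left ((hw3 i).2 d hd) hb
    simp only [Prod.fst_add, Prod.snd_add, Prod.smul_fst, Prod.smul_snd, smul_eq_mul,
      Pi.add_apply, Pi.smul_apply] at *
    linarith
  refine ⟨hK, ?_⟩
  rintro ⟨z, s⟩ ⟨hz, hs⟩ ⟨w, s'⟩ ⟨hw, hs'⟩ a b ha hb hab
  have hzw := hK hz hw ha hb hab
  refine ⟨hzw, ?_⟩
  obtain ⟨hs0, c₁, c₂, h1, h2, h3⟩ := (objPower_le_iff hne hq hC hz.2.2.2).1 hs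
  obtain ⟨hs0', c₁', c₂', h1', h2', h3'⟩ := (objPower_le_iff hne hq hC hw.2.2.2).1 hs'
  refine (objPower_le_iff hne hq hC hzw.2.2.2).2 ⟨add_nonneg (mul_nonneg ha hs0)
    (mul_nonneg hb hs0'), a * c₁ + b * c₁', a * c₂ + b * c₂',
    fun x hx => ?_, perspective_bound_combo hC ha hb h2 h2', ?_⟩
  · have := add_le_add (mul_le_mul_of_nonneg_left (h1 x hx) ha)
      (mul_le_mul_of_nonneg_left (h1' x hx) hb)
    rwa [← pairing_combo] at this
  · have e1 := mul_le_mul_of_nonneg_left h3 ha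
    have e2 := mul_le_mul_of_nonneg_left h3' hb
    have e3 := (concaveOn_const_mul_rpow hq zero_le_one).2 hs0 hs0' ha hb hab
    simp only [Prod.snd_add, Prod.smul_snd, smul_eq_mul,
      one_mul] at *
    linarith

end Programs

/-! ### Integration against discrete measures -/

section Discrete

variable {X : Type*} [MeasurableSpace X] {N : ℕ}

lemma map_discreteMeasure {Y : Type*} [MeasurableSpace Y] {g : X → Y} (hg : Measurable g)
    (z : Fin N → X) (p : Fin N → ℝ) :
    (discreteMeasure z p).map g = discreteMeasure (fun i => g (z i)) p := by
  ext s hs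
  simp only [discreteMeasure, Measure.map_apply hg hs, Measure.coe_finsetSum, Measure.coe_smul,
    Finset.sum_apply, Pi.smul_apply, Measure.dirac_apply' _ hs, Measure.dirac_apply' _ (hg hs)]
  rfl

lemma discreteMeasure_univ {z : Fin N → X} {p : Fin N → ℝ} (hp : ∀ i, 0 ≤ p i)
    (hp1 : ∑ i, p i = 1) : discreteMeasure z p univ = 1 := by
  simp only [discreteMeasure, Measure.coe_finsetSum, Measure.coe_smul, Finset.sum_apply,
    Pi.smul_apply, measure_univ, smul_eq_mul, mul_one]
  rw [← ENNReal.ofReal_sum_of_nonneg fun i _ => hp i, hp1, ENNReal.ofReal_one]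

variable [MeasurableSingletonClass X]

lemma lintegral_discreteMeasure (z : Fin N → X) (p : Fin N → ℝ) (g : X → ℝ≥0∞) :
    ∫⁻ x, g x ∂(discreteMeasure z p) = ∑ i, ENNReal.ofReal (p i) * g (z i) := by
  simp [discreteMeasure]

lemma integrable_discreteMeasure (z : Fin N → X) (p : Fin N → ℝ) (g : X → ℝ) :
    Integrable g (discreteMeasure z p) := by
  refine integrable_finsetSum_measure.2 fun i _ => ?_
  exact (integrable_dirac (by simp)).smul_measure ENNReal.ofReal_ne_top

lemma integral_discreteMeasure {z : Fin N → X} {p : Fin N → ℝ} (hp : ∀ i, 0 ≤ p i) (g : X → ℝ) :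
    ∫ x, g x ∂(discreteMeasure z p) = ∑ i, p i * g (z i) := by
  unfold discreteMeasure
  rw [integral_finsetSum_measure fun i _ =>
    (integrable_dirac (by simp)).smul_measure ENNReal.ofReal_ne_top]
  exact Finset.sum_congr rfl fun i _ => by
    rw [integral_smul_measure, integral_dirac, ENNReal.toReal_ofReal (hp i), smul_eq_mul]

end Discrete

/-! ### Near-optimal couplings and norming vectors -/

lemma otBall_radius_nonneg {E : Type*} [MeasurableSpace E] {D : E → E → ℝ} {δ : ℝ} {ν Q : Measure E}
    (hQ : Q ∈ otBall D δ ν) :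
    0 ≤ δ :=
  EReal.coe_nonneg.1 ((EReal.coe_ennreal_nonneg _).trans hQ.2)

/-- The slack `e > δ` avoids asking for an optimal coupling; it is removed later by continuity. -/
lemma exists_coupling_lt {E : Type*} [MeasurableSpace E] {D : E → E → ℝ} {δ e : ℝ} {ν Q : Measure E}
    (hQ : Q ∈ otBall D δ ν)
    (he : δ < e) :
    ∃ π ∈ couplings Q ν, ∫⁻ z, ENNReal.ofReal (D z.1 z.2) ∂π < ENNReal.ofReal e := by
  have h0 := otBall_radius_nonneg hQ
  have h1 : transportCost D Q ν < ENNReal.ofReal e := by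
    rw [← EReal.coe_ennreal_lt_coe_ennreal_iff, EReal.coe_ennreal_ofReal,
      max_eq_left (h0.trans he.le)]
    exact lt_of_le_of_lt hQ.2 (by exact_mod_cast he)
  simpa only [transportCost, iInf_lt_iff, exists_prop] using h1

/-- The closed unit ball is compact in finite dimension, so the dual norm is attained, up to a sign.
-/
lemma exists_norming_vector {E : Type*} [NormedAddCommGroup E] [NormedSpace ℝ E]
    [FiniteDimensional ℝ E] (α : StrongDual ℝ E) : ∃ u : E, ‖u‖ ≤ 1 ∧ α u = ‖α‖ := by
  have hK : IsCompact (Metric.closedBall (0 : E) 1) := isCompact_closedBall _ _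
  obtain ⟨u, hu, hmax⟩ := hK.exists_isMaxOn ⟨0, by simp⟩ α.continuous.norm.continuousOn
  have hu1 : ‖u‖ ≤ 1 := by simpa using hu
  have h1 : ‖α u‖ = ‖α‖ := by
    refine le_antisymm ((α.le_opNorm u).trans ?_) ?_
    · exact mul_le_of_le_one_right (norm_nonneg _) hu1
    · rw [← α.sSup_unitClosedBall_eq_norm]
      refine csSup_le (Set.Nonempty.image _ ⟨0, by simp⟩) ?_
      rintro _ ⟨x, hx, rfl⟩
      exact hmax hx
  rcases le_total 0 (α u) with h | h
  · exact ⟨u, hu1, by rwa [Real.norm_of_nonneg h] at h1⟩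
  · exact ⟨-u, by rwa [norm_neg], by rwa [Real.norm_of_nonpos h, ← map_neg] at h1⟩

/-! ### Upper bounds on expected losses -/

section Transport

variable {E : Type*} [NormedAddCommGroup E] [NormedSpace ℝ E] [FiniteDimensional ℝ E]
  [MeasurableSpace E] [BorelSpace E] {N : ℕ}

lemma memLp_discreteMeasure {X : Type*} [MeasurableSpace X] [MeasurableSingletonClass X]
    {q : ℝ} (hq : 1 ≤ q) (z : Fin N → X) (p : Fin N → ℝ) (g : X → ℝ) :
    MemLp g (ENNReal.ofReal q) (discreteMeasure z p) := by
  rw [← integrable_norm_rpow_iff (integrable_discreteMeasure z p g).aestronglyMeasurable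
    (by simp; linarith) ENNReal.ofReal_ne_top]
  exact integrable_discreteMeasure _ _ _

/-- The data of a nearly optimal coupling needed for the upper bounds on expected losses. -/
lemma exists_coupling_memLp {q K δ e : ℝ} (hq : 1 ≤ q) (hK : 0 ≤ K) {f : ℝ → ℝ}
    (hf : ∀ x y, |f x - f y| ≤ K * |x - y|) {yhat : Fin N → E} {p : Fin N → ℝ} {Q : Measure E}
    (hQ : Q ∈ otBall (powCost q) δ (discreteMeasure yhat p)) (he : δ < e) (α : StrongDual ℝ E) :
    ∃ π : Measure (E × E), IsProbabilityMeasure π ∧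
      MeasurePreserving Prod.fst π Q ∧ MeasurePreserving Prod.snd π (discreteMeasure yhat p) ∧
      MemLp (fun y => f (α y)) (ENNReal.ofReal q) Q ∧
      eLpNorm (fun z : E × E => f (α z.1) - f (α z.2)) (ENNReal.ofReal q) π ≤
        ENNReal.ofReal (K * ‖α‖ * e ^ (1 / q)) := by
  have h0 : 0 ≤ e := (otBall_radius_nonneg hQ).trans he.le
  have hq0 : 0 < q := by linarith
  obtain ⟨π, ⟨hπ1, hπ2⟩, hπ⟩ := exists_coupling_lt hQ he
  have hQp := hQ.1
  have hfst : MeasurePreserving Prod.fst π Q := ⟨measurable_fst, hπ1⟩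
  have hsnd : MeasurePreserving Prod.snd π (discreteMeasure yhat p) := ⟨measurable_snd, hπ2⟩
  have hπp : IsProbabilityMeasure π := ⟨by
    rw [← preimage_univ (f := Prod.fst), hfst.measure_preimage MeasurableSet.univ.nullMeasurableSet]
    exact measure_univ⟩
  have hfc : Continuous f := by
    have : LipschitzWith K.toNNReal f := LipschitzWith.of_dist_le_mul fun x y => by
      rw [Real.coe_toNNReal K hK]
      exact hf x y
    exact this.continuous
  have hfα : Continuous fun y => f (α y) := hfc.comp α.continuous
  have hqne : ENNReal.ofReal q ≠ 0 := by simpa using hq0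
  have hqr : (ENNReal.ofReal q).toReal = q := ENNReal.toReal_ofReal hq0.le
  have hdiff : eLpNorm (fun z : E × E => z.1 - z.2) (ENNReal.ofReal q) π ≤
      ENNReal.ofReal (e ^ (1 / q)) := by
    rw [eLpNorm_eq_lintegral_rpow_enorm_toReal hqne ENNReal.ofReal_ne_top, hqr,
      ← ENNReal.ofReal_rpow_of_nonneg h0 (by positivity)]
    refine ENNReal.rpow_le_rpow (le_trans (le_of_eq ?_) hπ.le) (by positivity)
    refine lintegral_congr fun z => ?_
    rw [powCost, ← ENNReal.ofReal_rpow_of_nonneg (norm_nonneg _) hq0.le, ofReal_norm]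
  have hh : eLpNorm (fun z : E × E => f (α z.1) - f (α z.2)) (ENNReal.ofReal q) π ≤
        ENNReal.ofReal (K * ‖α‖ * e ^ (1 / q)) := by
    refine (eLpNorm_le_mul_eLpNorm_of_ae_le_mul (c := K * ‖α‖)
      (g := fun z : E × E => z.1 - z.2) (Filter.Eventually.of_forall fun z => ?_) _).trans ?_
    · rw [Real.norm_eq_abs]
      refine (hf _ _).trans ?_
      rw [← map_sub, mul_assoc]
      exact mul_le_mul_of_nonneg_left (α.le_opNorm _) hK
    · rw [ENNReal.ofReal_mul (by positivity : 0 ≤ K * ‖α‖)]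
      exact mul_le_mul' le_rfl hdiff
  refine ⟨π, hπp, hfst, hsnd, ?_, hh⟩
  -- Integrability under `Q` comes from the coupling: `f (α z.1)` is an `L^q` difference plus `f (α
  -- z.2)`, whose law has finite support.
  have m1 : MemLp (fun z : E × E => f (α z.1) - f (α z.2)) (ENNReal.ofReal q) π :=
    ⟨((hfα.comp continuous_fst).sub (hfα.comp continuous_snd)).aestronglyMeasurable,
      hh.trans_lt ENNReal.ofReal_lt_top⟩
  have m2 : MemLp (fun z : E × E => f (α z.2)) (ENNReal.ofReal q) π :=
    (memLp_discreteMeasure hq yhat p fun y => f (α y)).comp_measurePreserving hsnd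
  have m3 : MemLp (fun z : E × E => f (α z.1)) (ENNReal.ofReal q) π := by
    convert m1.add m2 using 1
    ext z
    simp
  rw [← hπ1]
  exact (memLp_map_measure_iff hfα.aestronglyMeasurable measurable_fst.aemeasurable).2 m3

lemma integrable_of_lipschitz {q K δ : ℝ} (hq : 1 ≤ q) (hK : 0 ≤ K) {f : ℝ → ℝ}
    (hf : ∀ x y, |f x - f y| ≤ K * |x - y|) {yhat : Fin N → E} {p : Fin N → ℝ} {Q : Measure E}
    (hQ : Q ∈ otBall (powCost q) δ (discreteMeasure yhat p)) (α : StrongDual ℝ E) :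
    Integrable (fun y => f (α y)) Q := by
  obtain ⟨π, _, _, _, h, _⟩ := exists_coupling_memLp hq hK hf hQ (lt_add_one δ) α
  have := hQ.1
  exact h.integrable (by simpa using hq)

lemma integrable_rpow_of_lipschitz {q K δ : ℝ} (hq : 1 ≤ q) (hK : 0 ≤ K) {f : ℝ → ℝ}
    (hf : ∀ x y, |f x - f y| ≤ K * |x - y|) (hf0 : ∀ x, 0 ≤ f x)
    {yhat : Fin N → E} {p : Fin N → ℝ} {Q : Measure E}
    (hQ : Q ∈ otBall (powCost q) δ (discreteMeasure yhat p)) (α : StrongDual ℝ E) :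
    Integrable (fun y => f (α y) ^ q) Q := by
  obtain ⟨π, _, _, _, h, _⟩ := exists_coupling_memLp hq hK hf hQ (lt_add_one δ) α
  have := h.integrable_norm_rpow (by simp; linarith) ENNReal.ofReal_ne_top
  simpa only [ENNReal.toReal_ofReal (zero_le_one.trans hq), Real.norm_eq_abs,
    abs_of_nonneg (hf0 _)] using this

lemma le_of_forall_gt_rpow {q c δ u v : ℝ} (hq : 1 ≤ q)
    (h : ∀ e, δ < e → u ≤ v + c * e ^ (1 / q)) : u ≤ v + c * δ ^ (1 / q) := by
  have hc : Continuous fun e : ℝ => v + c * e ^ (1 / q) :=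
    continuous_const.add (continuous_const.mul (Real.continuous_rpow_const (by positivity)))
  have : Ici δ ⊆ {e : ℝ | u ≤ v + c * e ^ (1 / q)} := by
    rw [← closure_Ioi]
    exact (isClosed_le continuous_const hc).closure_subset_iff.2 h
  exact this (mem_Ici.2 le_rfl)

/-- The difference of the two means is an integral over the coupling, and on a probability space the
`L¹` norm is at most the `L^q` norm. -/
lemma integral_le_of_lipschitz {q K δ : ℝ} (hq : 1 ≤ q) (hK : 0 ≤ K) {f : ℝ → ℝ}
    (hf : ∀ x y, |f x - f y| ≤ K * |x - y|) {yhat : Fin N → E} {p : Fin N → ℝ}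
    (hp : ∀ i, 0 ≤ p i) {Q : Measure E}
    (hQ : Q ∈ otBall (powCost q) δ (discreteMeasure yhat p)) (α : StrongDual ℝ E) :
    ∫ y, f (α y) ∂Q ≤ ∑ i, p i * f (α (yhat i)) + K * ‖α‖ * δ ^ (1 / q) := by
  refine le_of_forall_gt_rpow hq fun e he => ?_
  obtain ⟨π, hπ, h1, h2, h3, h4⟩ := exists_coupling_memLp hq hK hf hQ he α
  have h0 : 0 ≤ e := (otBall_radius_nonneg hQ).trans he.le
  have := hQ.1
  have hq1 : (1 : ℝ≥0∞) ≤ ENNReal.ofReal q := by simpa using hq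
  have m1 := h3.integrable hq1
  have m2 := integrable_discreteMeasure yhat p fun y => f (α y)
  have i1 : Integrable (fun z : E × E => f (α z.1)) π := h1.integrable_comp_of_integrable m1
  have i2 : Integrable (fun z : E × E => f (α z.2)) π := h2.integrable_comp_of_integrable m2
  have e1 : ∫ y, f (α y) ∂Q = ∫ z, f (α z.1) ∂π := by
    rw [← h1.map_eq] at m1 ⊢
    exact integral_map measurable_fst.aemeasurable m1.aestronglyMeasurable
  have e2 : ∑ i, p i * f (α (yhat i)) = ∫ z, f (α z.2) ∂π := by
    rw [← integral_discreteMeasure hp fun y => f (α y)]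
    rw [← h2.map_eq] at m2 ⊢
    exact integral_map measurable_snd.aemeasurable m2.aestronglyMeasurable
  have e3 : ∫ z, (f (α z.1) - f (α z.2)) ∂π ≤ K * ‖α‖ * e ^ (1 / q) := by
    refine (Real.le_norm_self _).trans ((norm_integral_le_integral_norm _).trans ?_)
    have m3 : AEStronglyMeasurable (fun z : E × E => f (α z.1) - f (α z.2)) π :=
      (i1.sub i2).aestronglyMeasurable
    rw [integral_norm_eq_lintegral_enorm m3, ← eLpNorm_one_eq_lintegral_enorm]
    exact ENNReal.toReal_le_of_le_ofReal (by positivity)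
      ((eLpNorm_le_eLpNorm_of_exponent_le hq1 m3).trans h4)
  rw [integral_sub i1 i2] at e3
  linarith

/-- Minkowski's inequality in `L^q` of the coupling, applied to `f (α z.1) = f (α z.2) + (f (α z.1)
- f (α z.2))`. -/
lemma integral_rpow_le_of_lipschitz {q K δ : ℝ} (hq : 1 ≤ q) (hK : 0 ≤ K) {f : ℝ → ℝ}
    (hf : ∀ x y, |f x - f y| ≤ K * |x - y|) (hf0 : ∀ x, 0 ≤ f x)
    {yhat : Fin N → E} {p : Fin N → ℝ} (hp : ∀ i, 0 ≤ p i) {Q : Measure E}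
    (hQ : Q ∈ otBall (powCost q) δ (discreteMeasure yhat p)) (α : StrongDual ℝ E) :
    (∫ y, f (α y) ^ q ∂Q) ^ (1 / q) ≤
      (∑ i, p i * f (α (yhat i)) ^ q) ^ (1 / q) + K * ‖α‖ * δ ^ (1 / q) := by
  refine le_of_forall_gt_rpow hq fun e he => ?_
  obtain ⟨π, hπ, h1, h2, h3, h4⟩ := exists_coupling_memLp hq hK hf hQ he α
  have h0 : 0 ≤ e := (otBall_radius_nonneg hQ).trans he.le
  have hq0 : 0 < q := by linarith
  have hqne : ENNReal.ofReal q ≠ 0 := by simpa using hq0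
  have hqr : (ENNReal.ofReal q).toReal = q := ENNReal.toReal_ofReal hq0.le
  have hq1 : (1 : ℝ≥0∞) ≤ ENNReal.ofReal q := by simpa using hq
  have m2 := memLp_discreteMeasure hq yhat p fun y => f (α y)
  have n1 := h3.eLpNorm_eq_integral_rpow_norm hqne ENNReal.ofReal_ne_top
  have n2 := m2.eLpNorm_eq_integral_rpow_norm hqne ENNReal.ofReal_ne_top
  rw [integral_discreteMeasure hp] at n2
  simp only [hqr, Real.norm_eq_abs, abs_of_nonneg (hf0 _), ← one_div] at n1 n2
  have c1 : eLpNorm (fun z : E × E => f (α z.1)) (ENNReal.ofReal q) π =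
      eLpNorm (fun y => f (α y)) (ENNReal.ofReal q) Q :=
    eLpNorm_comp_measurePreserving h3.1 h1
  have c2 : eLpNorm (fun z : E × E => f (α z.2)) (ENNReal.ofReal q) π =
      eLpNorm (fun y => f (α y)) (ENNReal.ofReal q) (discreteMeasure yhat p) :=
    eLpNorm_comp_measurePreserving m2.1 h2
  have k1 : MemLp (fun z : E × E => f (α z.1)) (ENNReal.ofReal q) π :=
    h3.comp_measurePreserving h1
  have k2 : MemLp (fun z : E × E => f (α z.2)) (ENNReal.ofReal q) π :=
    m2.comp_measurePreserving h2
  have tri := eLpNorm_add_le k2.1 (k1.sub k2).1 hq1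
  have e1 : (fun z : E × E => f (α z.2)) + ((fun z : E × E => f (α z.1)) - fun z => f (α z.2)) =
      fun z => f (α z.1) := by
    ext z
    simp
  rw [e1, c1, c2, n1, n2] at tri
  have S0 : 0 ≤ ∑ i, p i * f (α (yhat i)) ^ q :=
    Finset.sum_nonneg fun i _ => mul_nonneg (hp i) (Real.rpow_nonneg (hf0 _) _)
  have tri2 := tri.trans (add_le_add_right h4 _)
  rw [← ENNReal.ofReal_add (by positivity) (by positivity),
    ENNReal.ofReal_le_ofReal_iff (by positivity)] at tri2
  exact tri2

/-! ### Adversarial distributions -/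

/-- From each atom `yhat i` a fraction `η` goes to `z i` and the rest stays, so a small `η` permits
long displacements at fixed cost. -/
lemma exists_mem_otBall {q δ η : ℝ} (hq : 1 ≤ q) {p : Fin N → ℝ} (hp : ∀ i, 0 ≤ p i)
    (hp1 : ∑ i, p i = 1) (hη0 : 0 ≤ η) (hη1 : η ≤ 1) (yhat z : Fin N → E)
    (hcost : η * ∑ i, p i * ‖z i - yhat i‖ ^ q ≤ δ) :
    ∃ Q ∈ otBall (powCost q) δ (discreteMeasure yhat p), ∀ g : E → ℝ,
      ∫ y, g y ∂Q = (1 - η) * ∑ i, p i * g (yhat i) + η * ∑ i, p i * g (z i) := by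
  have hη2 : 0 ≤ 1 - η := by linarith
  have hone : ENNReal.ofReal (1 - η) + ENNReal.ofReal η = 1 := by
    rw [← ENNReal.ofReal_add hη2 hη0, sub_add_cancel, ENNReal.ofReal_one]
  have hcost0 : 0 ≤ η * ∑ i, p i * ‖z i - yhat i‖ ^ q :=
    mul_nonneg hη0 (Finset.sum_nonneg fun i _ => mul_nonneg (hp i) (by positivity))
  refine ⟨ENNReal.ofReal (1 - η) • discreteMeasure yhat p + ENNReal.ofReal η • discreteMeasure z p,
    ⟨⟨?_⟩, ?_⟩, fun g => ?_⟩
  · simp only [Measure.coe_add, Measure.coe_smul, Pi.add_apply, Pi.smul_apply,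
      discreteMeasure_univ hp hp1, smul_eq_mul, mul_one, hone]
  · have hle : transportCost (powCost q) (ENNReal.ofReal (1 - η) • discreteMeasure yhat p +
        ENNReal.ofReal η • discreteMeasure z p) (discreteMeasure yhat p) ≤
        ENNReal.ofReal (η * ∑ i, p i * ‖z i - yhat i‖ ^ q) := by
      have hmem : ENNReal.ofReal (1 - η) • discreteMeasure (fun i => (yhat i, yhat i)) p +
          ENNReal.ofReal η • discreteMeasure (fun i => (z i, yhat i)) p ∈
          couplings (ENNReal.ofReal (1 - η) • discreteMeasure yhat p +
            ENNReal.ofReal η • discreteMeasure z p) (discreteMeasure yhat p) := by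
        constructor
        · rw [Measure.map_add _ _ measurable_fst, Measure.map_smul, Measure.map_smul,
            map_discreteMeasure measurable_fst, map_discreteMeasure measurable_fst]
        · rw [Measure.map_add _ _ measurable_snd, Measure.map_smul, Measure.map_smul,
            map_discreteMeasure measurable_snd, map_discreteMeasure measurable_snd, ← add_smul,
            hone, one_smul]
      refine (iInf₂_le _ hmem).trans ?_
      rw [lintegral_add_measure, lintegral_smul_measure, lintegral_smul_measure,
        lintegral_discreteMeasure, lintegral_discreteMeasure, ENNReal.ofReal_mul hη0,
        ENNReal.ofReal_sum_of_nonneg fun i _ => mul_nonneg (hp i) (by positivity)]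
      simp only [powCost, sub_self, norm_zero, Real.zero_rpow (by linarith : q ≠ 0),
        ENNReal.ofReal_zero, mul_zero, Finset.sum_const_zero, smul_eq_mul, zero_add,
        ENNReal.ofReal_mul (hp _), le_refl]
    refine (EReal.coe_ennreal_le_coe_ennreal_iff.2 hle).trans ?_
    rw [EReal.coe_ennreal_ofReal, max_eq_left hcost0]
    exact_mod_cast hcost
  · rw [integral_add_measure
      ((integrable_discreteMeasure _ _ _).smul_measure ENNReal.ofReal_ne_top)
      ((integrable_discreteMeasure _ _ _).smul_measure ENNReal.ofReal_ne_top),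
      integral_smul_measure, integral_smul_measure, integral_discreteMeasure hp,
      integral_discreteMeasure hp, ENNReal.toReal_ofReal hη0, ENNReal.toReal_ofReal hη2,
      smul_eq_mul, smul_eq_mul]

end Transport

/-! ### Structure of the losses -/

lemma abs_combo_le {a b x y c : ℝ} (ha : 0 ≤ a) (hb : 0 ≤ b) (hab : a + b = 1) :
    |a * x + b * y - c| ≤ a * |x - c| + b * |y - c| := by
  have h : a * x + b * y - c = a * (x - c) + b * (y - c) := by
    linear_combination c * hab
  rw [h]
  refine (abs_add_le _ _).trans ?_
  rw [abs_mul, abs_mul, abs_of_nonneg ha, abs_of_nonneg hb]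

lemma convexOn_abs_sub (c : ℝ) : ConvexOn ℝ univ fun x : ℝ => |x - c| :=
  ⟨convex_univ, fun _ _ _ _ _ _ ha hb hab => abs_combo_le ha hb hab⟩

lemma convexOn_sub_const (c : ℝ) : ConvexOn ℝ univ fun x : ℝ => x - c :=
  ⟨convex_univ, fun x _ y _ a b _ _ hab => le_of_eq (by
    simp only [smul_eq_mul]
    linear_combination c * hab)⟩

lemma exists_direction_abs (x c : ℝ) :
    ∃ s : ℝ, |s| ≤ 1 ∧ ∀ τ, 0 ≤ τ → |x + s * τ - c| = |x - c| + τ := by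
  rcases le_total c x with h | h
  · refine ⟨1, by simp, fun τ hτ => ?_⟩
    rw [abs_of_nonneg (by linarith), abs_of_nonneg (by linarith)]
    ring
  · refine ⟨-1, by simp, fun τ hτ => ?_⟩
    rw [abs_of_nonpos (by linarith), abs_of_nonpos (by linarith)]
    ring

lemma IsAffineOrAbsLoss.properties {C : ℝ} (hC : 0 < C) {ℓ : ℝ → ℝ} (h : IsAffineOrAbsLoss C ℓ) :
    ConvexOn ℝ univ ℓ ∧ (∀ x y, |ℓ x - ℓ y| ≤ C * |x - y|) ∧
      ∀ x, ∃ s : ℝ, |s| ≤ 1 ∧ ∀ τ, 0 ≤ τ → ℓ x + C * τ ≤ ℓ (x + s * τ) := by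
  have hdist : ∀ u v w : ℝ, |u - v| ≤ w → |C * u - C * v| ≤ C * w := fun u v w h => by
    rw [← mul_sub, abs_mul, abs_of_pos hC]
    exact mul_le_mul_of_nonneg_left h hC.le
  rcases h with ⟨b, rfl⟩ | ⟨b, rfl⟩ | ⟨b₁, b₂, rfl⟩
  · refine ⟨⟨convex_univ, fun x _ y _ a b' _ _ hab => le_of_eq ?_⟩,
      fun x y => hdist _ _ _ (le_of_eq (by ring_nf)), fun x => ⟨1, by simp, fun τ _ => le_of_eq (by ring)⟩⟩
    simp only [smul_eq_mul]
    linear_combination (-(C * b)) * hab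
  · refine ⟨⟨convex_univ, fun x _ y _ a b' _ _ hab => le_of_eq ?_⟩,
      fun x y => hdist _ _ _ (le_of_eq ?_), fun x => ⟨-1, by simp, fun τ _ => le_of_eq (by ring)⟩⟩
    · simp only [smul_eq_mul]
      linear_combination (-(C * b)) * hab
    · rw [abs_sub_comm x y]
      ring_nf
  · refine ⟨((convexOn_abs_sub b₁).add_const b₂).smul hC.le, fun x y => hdist _ _ _ ?_, fun x => ?_⟩
    · have := abs_abs_sub_abs_le (x - b₁) (y - b₁)
      simpa using this
    · obtain ⟨s, hs, h⟩ := exists_direction_abs x b₁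
      refine ⟨s, hs, fun τ hτ => le_of_eq ?_⟩
      simp only [h τ hτ]
      ring

/-- What the worst-case analysis uses about the base `f` of a power loss `f ^ q`. -/
structure IsPowerBase (C : ℝ) (f : ℝ → ℝ) : Prop where
  nonneg : ∀ x, 0 ≤ f x
  convexOn : ConvexOn ℝ univ f
  abs_sub_le : ∀ x y, |f x - f y| ≤ C * |x - y|
  -- Restricted to `0 < f x`, because a positive part can be flat near its zeros.
  exists_direction : ∀ x, ∃ s : ℝ, |s| ≤ 1 ∧ (0 < f x → ∀ τ, 0 ≤ τ → f x + C * τ ≤ f (x + s * τ))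
  -- Growth up to a constant covers the case of zero nominal risk.
  exists_growth : ∃ s : ℝ, |s| ≤ 1 ∧ ∀ x, ∃ c, ∀ τ, 0 ≤ τ → C * τ - c ≤ f (x + s * τ)

lemma IsPowerBase.const_mul {C : ℝ} (hC : 0 < C) {f : ℝ → ℝ} (hf : IsPowerBase 1 f) :
    IsPowerBase C fun x => C * f x where
  nonneg x := mul_nonneg hC.le (hf.nonneg x)
  convexOn := hf.convexOn.smul hC.le
  abs_sub_le x y := by
    have := mul_le_mul_of_nonneg_left (hf.abs_sub_le x y) hC.le
    rwa [one_mul, ← abs_of_pos hC, ← abs_mul, abs_of_pos hC, mul_sub] at this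
  exists_direction x := by
    obtain ⟨s, hs, h⟩ := hf.exists_direction x
    refine ⟨s, hs, fun hx τ hτ => ?_⟩
    have := mul_le_mul_of_nonneg_left (h (pos_of_mul_pos_right hx hC.le) τ hτ) hC.le
    linarith
  exists_growth := by
    obtain ⟨s, hs, h⟩ := hf.exists_growth
    refine ⟨s, hs, fun x => ?_⟩
    obtain ⟨c, hc⟩ := h x
    refine ⟨C * c, fun τ hτ => ?_⟩
    have := mul_le_mul_of_nonneg_left (hc τ hτ) hC.le
    linarith

/-- The positive part of a function that grows at unit rate in some direction from each point. -/
lemma IsPowerBase.of_max {g : ℝ → ℝ} (hg : ConvexOn ℝ univ g)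
    (hl : ∀ x y, |g x - g y| ≤ |x - y|)
    (hd : ∀ x, ∃ s : ℝ, |s| ≤ 1 ∧ ∀ τ, 0 ≤ τ → g x + τ ≤ g (x + s * τ))
    (hr : ∃ s : ℝ, |s| ≤ 1 ∧ ∀ x, ∃ c, ∀ τ, 0 ≤ τ → τ - c ≤ g (x + s * τ)) :
    IsPowerBase 1 fun x => max (g x) 0 where
  nonneg x := le_max_right _ _
  convexOn := hg.sup (convexOn_const 0 convex_univ)
  abs_sub_le x y := by
    rw [one_mul]
    exact (abs_max_sub_max_le_abs _ _ _).trans (hl x y)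
  exists_direction x := by
    obtain ⟨s, hs, h⟩ := hd x
    refine ⟨s, hs, fun hx τ hτ => ?_⟩
    have hx' : 0 < g x := by simpa using hx
    rw [max_eq_left hx'.le, one_mul]
    exact (h τ hτ).trans (le_max_left _ _)
  exists_growth := by
    obtain ⟨s, hs, h⟩ := hr
    refine ⟨s, hs, fun x => ?_⟩
    obtain ⟨c, hc⟩ := h x
    exact ⟨c, fun τ hτ => by rw [one_mul]; exact (hc τ hτ).trans (le_max_left _ _)⟩

lemma exists_growth_abs (b c : ℝ) :
    ∃ s : ℝ, |s| ≤ 1 ∧ ∀ x, ∃ k, ∀ τ, 0 ≤ τ → τ - k ≤ |x + s * τ - b| + c :=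
  ⟨1, by simp, fun x => ⟨b - x - c, fun τ _ => by
    linarith [le_abs_self (x + 1 * τ - b)]⟩⟩

lemma abs_abs_sub_sub_le (x y b : ℝ) : |(|x - b| - |y - b|)| ≤ |x - y| := by
  simpa using abs_abs_sub_abs_le (x - b) (y - b)

lemma IsPowerLoss.exists_base {q C : ℝ} (hC : 0 < C) {ℓ : ℝ → ℝ} (h : IsPowerLoss q C ℓ) :
    ∃ f : ℝ → ℝ, IsPowerBase C f ∧ ℓ = fun x => f x ^ q := by
  rcases h with ⟨b, rfl⟩ | ⟨b, rfl⟩ | ⟨b₁, b₂, hb, rfl⟩ | ⟨b₁, b₂, hb, rfl⟩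
  · refine ⟨_, (IsPowerBase.of_max (convexOn_sub_const b) (fun x y => le_of_eq (by ring_nf))
      (fun x => ⟨1, by simp, fun τ _ => le_of_eq (by ring)⟩)
      ⟨1, by simp, fun x => ⟨b - x, fun τ _ => le_of_eq (by ring)⟩⟩).const_mul hC, rfl⟩
  · refine ⟨_, (IsPowerBase.of_max (g := fun x => -(x - b)) ⟨convex_univ, fun x _ y _ a c _ _ hab =>
      le_of_eq ?_⟩ (fun x y => le_of_eq ?_)
      (fun x => ⟨-1, by simp, fun τ _ => le_of_eq (by ring)⟩)
      ⟨-1, by simp, fun x => ⟨x - b, fun τ _ => le_of_eq (by ring)⟩⟩).const_mul hC, rfl⟩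
    · simp only [smul_eq_mul]
      linear_combination (-b) * hab
    · rw [abs_sub_comm x y]
      ring_nf
  · refine ⟨_, (IsPowerBase.of_max (g := fun x => |x - b₁| - b₂)
      ((convexOn_abs_sub b₁).add_const (-b₂)) (fun x y => ?_) (fun x => ?_)
      (exists_growth_abs b₁ (-b₂))).const_mul hC, rfl⟩
    · simpa using abs_abs_sub_sub_le x y b₁
    · obtain ⟨s, hs, h⟩ := exists_direction_abs x b₁
      exact ⟨s, hs, fun τ hτ => by simp only [h τ hτ]; linarith⟩
  · refine ⟨_, IsPowerBase.const_mul (f := fun x => |x - b₁| + b₂) hC ?_, rfl⟩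
    refine ⟨fun x => by positivity, (convexOn_abs_sub b₁).add_const b₂, fun x y => ?_, fun x => ?_, ?_⟩
    · simpa using abs_abs_sub_sub_le x y b₁
    · obtain ⟨s, hs, h⟩ := exists_direction_abs x b₁
      exact ⟨s, hs, fun _ τ hτ => by simp only [h τ hτ]; linarith⟩
    · simpa only [one_mul] using exists_growth_abs b₁ b₂

/-- By convexity the slope `K` reached on `[x, y]` persists beyond `y`; before `y` only a bounded
range of `τ` remains, absorbed into `c` by the Lipschitz bound. -/
lemma exists_bound_of_slope {ℓ : ℝ → ℝ} {K M x y : ℝ} (hℓ : ConvexOn ℝ univ ℓ) (hM : 0 ≤ M)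
    (hl : ∀ x y, |ℓ x - ℓ y| ≤ M * |x - y|) (hK : 0 ≤ K) (hxy : x < y)
    (hs : K * (y - x) ≤ ℓ y - ℓ x) (a : ℝ) : ∃ c, ∀ τ, 0 ≤ τ → K * τ - c ≤ ℓ (a + τ) := by
  have hB : ∀ w, y ≤ w → ℓ y + K * (w - y) ≤ ℓ w := by
    intro w hw
    rcases eq_or_lt_of_le hw with rfl | hw
    · simp
    · have h1 := hℓ.slope_mono_adjacent (mem_univ x) (mem_univ w) hxy hw
      have h2 : K ≤ (ℓ y - ℓ x) / (y - x) := by rwa [le_div_iff₀ (sub_pos.2 hxy)]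
      have h3 := h2.trans h1
      rw [le_div_iff₀ (sub_pos.2 hw)] at h3
      linarith
  refine ⟨-ℓ y + |K * (y - a)| + |M * (y - a)|, fun τ hτ => ?_⟩
  have e1 := le_abs_self (K * (y - a))
  have e2 := le_abs_self (M * (y - a))
  rcases le_total y (a + τ) with h | h
  · have e3 := hB _ h
    linarith [abs_nonneg (M * (y - a))]
  · have e3 := (abs_le.1 (hl (a + τ) y)).1
    rw [abs_of_nonpos (by linarith : a + τ - y ≤ 0)] at e3
    have e4 := mul_le_mul_of_nonneg_left (by linarith : τ ≤ y - a) hK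
    have e5 := mul_nonneg hM hτ
    linarith

/-- Some chord is steeper than `K`, and convexity carries its slope to infinity; a descending chord
is handled by reflection. -/
lemma exists_growth_of_lt_lipConst {ℓ : ℝ → ℝ} {K : ℝ} (hℓ : ConvexOn ℝ univ ℓ)
    (hL : ∃ K : ℝ≥0, LipschitzWith K ℓ) (hK : 0 ≤ K) (hKl : K < lipConst ℓ) :
    ∃ s : ℝ, |s| ≤ 1 ∧ ∀ x, ∃ c, ∀ τ, 0 ≤ τ → K * τ - c ≤ ℓ (x + s * τ) := by
  have hl := abs_sub_le_lipConst hL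
  have hM := lipConst_nonneg ℓ
  obtain ⟨x, y, hxy⟩ : ∃ x y, K * |y - x| < ℓ y - ℓ x := by
    by_contra! h
    refine absurd hKl (not_lt.2 (csInf_le ⟨0, fun _ h => h.1⟩ ⟨hK, fun x y => ?_⟩))
    rw [abs_le]
    have h1 := h x y
    have h2 := h y x
    rw [abs_sub_comm y x] at h1
    exact ⟨by linarith, by linarith⟩
  rcases lt_trichotomy x y with h | h | h
  · rw [abs_of_pos (sub_pos.2 h)] at hxy
    exact ⟨1, by simp, fun a => by
      simpa only [one_mul] using exists_bound_of_slope hℓ hM hl hK h hxy.le a⟩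
  · simp [h] at hxy
  · rw [abs_of_neg (sub_neg.2 h)] at hxy
    have hneg : ConvexOn ℝ univ fun x => ℓ (-x) :=
      ⟨convex_univ, fun x _ y _ a b ha hb hab => by
        have := hℓ.2 (mem_univ (-x)) (mem_univ (-y)) ha hb hab
        simp only [smul_eq_mul] at *
        convert this using 2
        ring⟩
    refine ⟨-1, by simp, fun a => ?_⟩
    obtain ⟨c, hc⟩ := exists_bound_of_slope (x := -x) (y := -y) hneg hM (fun u v => by
      refine (hl _ _).trans (le_of_eq ?_)
      rw [← abs_neg (u - v)]
      ring_nf) hK (neg_lt_neg h) (by simp only [neg_neg]; linarith) (-a)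
    refine ⟨c, fun τ hτ => ?_⟩
    have := hc τ hτ
    simp only [neg_add_rev, neg_neg] at this
    convert this using 2
    ring

/-! ### The worst case over the union ball -/

section WorstCase

variable {E : Type*} [NormedAddCommGroup E] [NormedSpace ℝ E]
  [MeasurableSpace E] {N : ℕ} {yhat : Fin N → E}
  {V : Set ((Fin N → ℝ) × ℝ)}

lemma worstCase_le_iff {D : E → E → ℝ} {ℓ : ℝ → ℝ} {α : StrongDual ℝ E} {R : ℝ} :
    worstCase D yhat V ℓ α ≤ (R : EReal) ↔ ∀ Q ∈ unionBall D yhat V, ∫ y, ℓ (α y) ∂Q ≤ R := by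
  simp only [worstCase, iSup_le_iff, EReal.coe_le_coe_iff]

lemma exists_of_mem_unionBall {E : Type*} [MeasurableSpace E] {yhat : Fin N → E}
    {D : E → E → ℝ} {Q : Measure E} (hQ : Q ∈ unionBall D yhat V) :
    ∃ x ∈ nonnegPart V, Q ∈ otBall D x.2 (discreteMeasure yhat x.1) := by
  simp only [unionBall, mem_iUnion, exists_prop] at hQ
  obtain ⟨x, hx, h⟩ := hQ
  exact ⟨x, ⟨hx, otBall_radius_nonneg h⟩, h⟩

variable [FiniteDimensional ℝ E] [BorelSpace E]

/-- Moving atom `i` by `s i * t i` along a norming vector changes `α` by exactly `s i * t i * ‖α‖`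
at cost at most `t i ^ q`. -/
lemma shifted_risk_le (hVp : ∀ x ∈ V, (∀ i, 0 ≤ x.1 i) ∧ ∑ i, x.1 i = 1) {q R η : ℝ}
    (hq : 1 ≤ q) {ℓ : ℝ → ℝ} {α : StrongDual ℝ E}
    (hR : worstCase (powCost q) yhat V ℓ α ≤ (R : EReal)) {x : (Fin N → ℝ) × ℝ}
    (hx : x ∈ nonnegPart V) (hη0 : 0 ≤ η) (hη1 : η ≤ 1) {s t : Fin N → ℝ} (hs : ∀ i, |s i| ≤ 1)
    (ht : ∀ i, 0 ≤ t i) (hcost : η * ∑ i, x.1 i * t i ^ q ≤ x.2) :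
    (1 - η) * ∑ i, x.1 i * ℓ (α (yhat i)) +
      η * ∑ i, x.1 i * ℓ (α (yhat i) + s i * (t i * ‖α‖)) ≤ R := by
  obtain ⟨hp, hp1⟩ := hVp x hx.1
  obtain ⟨u, hu, hαu⟩ := exists_norming_vector α
  obtain ⟨Q, hQ, hint⟩ := exists_mem_otBall (δ := x.2) hq hp hp1 hη0 hη1 yhat
    (fun i => yhat i + (s i * t i) • u) (by
      refine le_trans (mul_le_mul_of_nonneg_left (Finset.sum_le_sum fun i _ =>
        mul_le_mul_of_nonneg_left ?_ (hp i)) hη0) hcost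
      refine Real.rpow_le_rpow (norm_nonneg _) ?_ (by linarith)
      rw [add_sub_cancel_left, norm_smul, Real.norm_eq_abs, abs_mul, abs_of_nonneg (ht i)]
      exact (mul_le_of_le_one_right (mul_nonneg (abs_nonneg _) (ht i)) hu).trans
        (mul_le_of_le_one_left (ht i) (hs i)))
  have h := worstCase_le_iff.1 hR Q (mem_iUnion₂.2 ⟨x, hx.1, hQ⟩)
  rw [hint] at h
  simpa only [map_add, map_smul, hαu, smul_eq_mul, mul_assoc] using h

end WorstCase

section WorstCase

variable {E : Type*} [NormedAddCommGroup E] [NormedSpace ℝ E] [FiniteDimensional ℝ E]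
  [MeasurableSpace E] [BorelSpace E] {N : ℕ} {yhat : Fin N → E} {V : Set ((Fin N → ℝ) × ℝ)}

lemma worstCase_eq_robustLipschitz (hVp : ∀ x ∈ V, (∀ i, 0 ≤ x.1 i) ∧ ∑ i, x.1 i = 1) {ℓ : ℝ → ℝ}
    (hℓ : ConvexOn ℝ univ ℓ) (hL : ∃ K : ℝ≥0, LipschitzWith K ℓ) (α : StrongDual ℝ E) :
    worstCase (powCost 1) yhat V ℓ α = robustLipschitz yhat V ℓ α := by
  refine le_antisymm (le_of_forall_coe_le fun R hR => ?_) (le_of_forall_coe_le fun R hR => ?_)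
  · rw [robustLipschitz_le_iff] at hR
    refine worstCase_le_iff.2 fun Q hQ => ?_
    obtain ⟨x, hx, hQx⟩ := exists_of_mem_unionBall hQ
    refine (integral_le_of_lipschitz le_rfl (lipConst_nonneg ℓ) (abs_sub_le_lipConst hL)
      (hVp x hx.1).1 hQx α).trans ((le_of_eq ?_).trans (hR x hx))
    rw [one_div_one, Real.rpow_one]
    ring
  · refine robustLipschitz_le_iff.2 fun x hx => ?_
    obtain ⟨hp, hp1⟩ := hVp x hx.1
    have hδ := hx.2
    set S := ∑ i, x.1 i * ℓ (α (yhat i)) with hS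
    have hK : ∀ K, 0 ≤ K → K < lipConst ℓ → S + K * x.2 * ‖α‖ ≤ R := by
      intro K hK0 hKl
      obtain ⟨s, hs, hgr⟩ := exists_growth_of_lt_lipConst hℓ hL hK0 hKl
      choose c hc using hgr
      set c' := ∑ i, x.1 i * c (α (yhat i)) with hc'
      -- Mass `η` moved a distance `δ / η` spends the budget `δ` exactly; the gain does not shrink
      -- with `η`, while the error does.
      have hη : ∀ η, 0 < η → η ≤ 1 → S + K * x.2 * ‖α‖ ≤ R + η * (S + c') := by
        intro η hη0 hη1
        have h := shifted_risk_le hVp le_rfl hR hx hη0.le hη1 (s := fun _ => s)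
          (t := fun _ => x.2 / η) (fun _ => hs) (fun _ => by positivity) (by
            rw [← Finset.sum_mul, hp1, one_mul, Real.rpow_one, mul_div_cancel₀ _ hη0.ne'])
        have h2 : K * (x.2 / η * ‖α‖) - c' ≤
            ∑ i, x.1 i * ℓ (α (yhat i) + s * (x.2 / η * ‖α‖)) := by
          calc K * (x.2 / η * ‖α‖) - c'
              = ∑ i, x.1 i * (K * (x.2 / η * ‖α‖) - c (α (yhat i))) := by
                simp only [mul_sub, Finset.sum_sub_distrib]
                rw [← Finset.sum_mul, hp1, one_mul]
            _ ≤ _ := Finset.sum_le_sum fun i _ =>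
              mul_le_mul_of_nonneg_left (hc _ _ (by positivity)) (hp i)
        have h3 := mul_le_mul_of_nonneg_left h2 hη0.le
        have h4 : η * (K * (x.2 / η * ‖α‖) - c') = K * x.2 * ‖α‖ - η * c' := by
          field_simp
        linarith
      refine le_of_forall_pos_le_add fun e he => ?_
      have hpos : 0 < |S + c'| + 1 := by positivity
      have h := hη (min 1 (e / (|S + c'| + 1))) (lt_min one_pos (by positivity)) (min_le_left _ _)
      have h2 : min 1 (e / (|S + c'| + 1)) * (S + c') ≤ e := by
        calc min 1 (e / (|S + c'| + 1)) * (S + c')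
            ≤ min 1 (e / (|S + c'| + 1)) * (|S + c'| + 1) :=
              mul_le_mul_of_nonneg_left (by linarith [le_abs_self (S + c')]) (by positivity)
          _ ≤ e / (|S + c'| + 1) * (|S + c'| + 1) :=
              mul_le_mul_of_nonneg_right (min_le_right _ _) hpos.le
          _ = e := div_mul_cancel₀ _ hpos.ne'
      linarith
    -- If the Lipschitz constant is `0` there is no admissible `K` below it, and the unmoved
    -- distribution suffices.
    rcases eq_or_lt_of_le (lipConst_nonneg ℓ) with h0 | h0
    · have h := shifted_risk_le hVp le_rfl hR hx le_rfl zero_le_one (s := 0) (t := 0)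
        (by simp) (by simp) (by simpa using hδ)
      rw [← h0]
      linarith
    · have hcl : IsClosed {K : ℝ | S + K * x.2 * ‖α‖ ≤ R} :=
        isClosed_le (by fun_prop) continuous_const
      have hsub : Icc 0 (lipConst ℓ) ⊆ {K : ℝ | S + K * x.2 * ‖α‖ ≤ R} := by
        rw [← closure_Ico h0.ne]
        exact hcl.closure_subset_iff.2 fun K h => hK K h.1 h.2
      exact hsub (right_mem_Icc.2 h0.le)

lemma worstCase_eq_robustAffine (hVp : ∀ x ∈ V, (∀ i, 0 ≤ x.1 i) ∧ ∑ i, x.1 i = 1) {q C : ℝ}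
    (hq : 1 < q) (hC : 0 < C) {ℓ : ℝ → ℝ} (hl : ∀ x y, |ℓ x - ℓ y| ≤ C * |x - y|)
    (hd : ∀ x, ∃ s : ℝ, |s| ≤ 1 ∧ ∀ τ, 0 ≤ τ → ℓ x + C * τ ≤ ℓ (x + s * τ))
    (α : StrongDual ℝ E) :
    worstCase (powCost q) yhat V ℓ α = robustAffine q C yhat V ℓ α := by
  have hq0 : 0 < q := by linarith
  refine le_antisymm (le_of_forall_coe_le fun R hR => ?_) (le_of_forall_coe_le fun R hR => ?_)
  · rw [robustAffine_le_iff] at hR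
    refine worstCase_le_iff.2 fun Q hQ => ?_
    obtain ⟨x, hx, hQx⟩ := exists_of_mem_unionBall hQ
    refine (integral_le_of_lipschitz hq.le hC.le hl
      (hVp x hx.1).1 hQx α).trans ((le_of_eq ?_).trans (hR x hx))
    ring
  · refine robustAffine_le_iff.2 fun x hx => ?_
    obtain ⟨hp, hp1⟩ := hVp x hx.1
    have hδ := hx.2
    choose s hs hgr using hd
    -- All mass moves the same distance `δ ^ (1 / q)`, the equality case of the `L¹`-`L^q`
    -- comparison.
    have h := shifted_risk_le hVp hq.le hR hx zero_le_one le_rfl (s := fun i => s (α (yhat i)))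
      (t := fun _ => x.2 ^ (1 / q)) (fun i => hs _) (fun _ => by positivity) (by
        rw [← Finset.sum_mul, hp1, one_mul, one_mul, ← Real.rpow_mul hδ,
          one_div_mul_cancel hq0.ne', Real.rpow_one])
    rw [sub_self, zero_mul, zero_add, one_mul] at h
    refine le_trans ?_ h
    calc ∑ i, x.1 i * ℓ (α (yhat i)) + C * x.2 ^ (1 / q) * ‖α‖
        = ∑ i, x.1 i * (ℓ (α (yhat i)) + C * (x.2 ^ (1 / q) * ‖α‖)) := by
          simp only [mul_add, Finset.sum_add_distrib]
          rw [← Finset.sum_mul, hp1, one_mul, mul_assoc]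
      _ ≤ _ := Finset.sum_le_sum fun i _ =>
          mul_le_mul_of_nonneg_left (hgr _ _ (by positivity)) (hp i)

lemma worstCase_eq_robustPower (hVp : ∀ x ∈ V, (∀ i, 0 ≤ x.1 i) ∧ ∑ i, x.1 i = 1) {q C : ℝ}
    (hq : 1 < q) (hC : 0 < C) {f : ℝ → ℝ} (hf : IsPowerBase C f) (α : StrongDual ℝ E) :
    worstCase (powCost q) yhat V (fun x => f x ^ q) α =
      robustPower q C yhat V (fun x => f x ^ q) α := by
  have hq0 : 0 < q := by linarith
  have hcancel : ∀ {a : ℝ}, 0 ≤ a → (a ^ (1 / q)) ^ q = a := fun ha => by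
    rw [← Real.rpow_mul ha, one_div_mul_cancel hq0.ne', Real.rpow_one]
  have hcancel' : ∀ {a : ℝ}, 0 ≤ a → (a ^ q) ^ (1 / q) = a := fun ha => by
    rw [← Real.rpow_mul ha, mul_one_div_cancel hq0.ne', Real.rpow_one]
  have hfq : ∀ x, 0 ≤ f x ^ q := fun x => Real.rpow_nonneg (hf.nonneg x) q
  refine le_antisymm (le_of_forall_coe_le fun R hR => ?_) (le_of_forall_coe_le fun R hR => ?_)
  · rw [robustPower_le_iff] at hR
    refine worstCase_le_iff.2 fun Q hQ => ?_
    obtain ⟨x, hx, hQx⟩ := exists_of_mem_unionBall hQ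
    have h := integral_rpow_le_of_lipschitz hq.le hC.le hf.abs_sub_le hf.nonneg
      (hVp x hx.1).1 hQx α
    have hI : 0 ≤ ∫ y, f (α y) ^ q ∂Q := integral_nonneg fun y => hfq _
    have h2 := Real.rpow_le_rpow (by positivity) h hq0.le
    rw [hcancel hI, mul_right_comm C] at h2
    exact h2.trans (hR x hx)
  · refine robustPower_le_iff.2 fun x hx => ?_
    obtain ⟨hp, hp1⟩ := hVp x hx.1
    have hδ := hx.2
    set S := ∑ i, x.1 i * f (α (yhat i)) ^ q with hS
    have hS0 : 0 ≤ S := Finset.sum_nonneg fun i _ => mul_nonneg (hp i) (hfq _)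
    -- With zero nominal risk there need be no direction of immediate growth, so a mass `η` is sent
    -- to distance `(δ / η) ^ (1 / q)`. After taking roots the constant `k` contributes only `k * η
    -- ^ (1 / q)`.
    rcases eq_or_lt_of_le hS0 with h0 | h0
    · have hR0 : 0 ≤ R := by
        have h := shifted_risk_le hVp hq.le hR hx le_rfl zero_le_one (s := 0) (t := 0)
          (by simp) (by simp) (by simpa using hδ)
        linarith
      obtain ⟨s, hs, hgr⟩ := hf.exists_growth
      choose c hc using hgr
      set k := ∑ i, |c (α (yhat i))| with hk
      have hk0 : 0 ≤ k := Finset.sum_nonneg fun i _ => abs_nonneg _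
      have hη : ∀ η, 0 < η → η ≤ 1 → C * x.2 ^ (1 / q) * ‖α‖ ≤ R ^ (1 / q) + k * η ^ (1 / q) := by
        intro η hη0 hη1
        set t := (x.2 / η) ^ (1 / q) with ht
        have ht0 : 0 ≤ t := by positivity
        have htη : η ^ (1 / q) * t = x.2 ^ (1 / q) := by
          rw [ht, ← Real.mul_rpow hη0.le (by positivity), mul_div_cancel₀ _ hη0.ne']
        have h := shifted_risk_le hVp hq.le hR hx hη0.le hη1 (s := fun _ => s)
          (t := fun _ => t) (fun _ => hs) (fun _ => ht0) (by
            rw [← Finset.sum_mul, hp1, one_mul, ht, hcancel (by positivity),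
              mul_div_cancel₀ _ hη0.ne'])
        rw [← hS, ← h0, mul_zero, zero_add] at h
        rcases lt_or_ge (C * (t * ‖α‖) - k) 0 with hv | hv
        · have h1 := mul_le_mul_of_nonneg_left hv.le (Real.rpow_nonneg hη0.le (1 / q))
          have h2 : 0 ≤ R ^ (1 / q) := by positivity
          have h3 : C * x.2 ^ (1 / q) * ‖α‖ = η ^ (1 / q) * (C * (t * ‖α‖)) := by
            rw [← htη]
            ring
          linarith
        · have h1 : (C * (t * ‖α‖) - k) ^ q ≤
              ∑ i, x.1 i * f (α (yhat i) + s * (t * ‖α‖)) ^ q := by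
            rw [← one_mul ((C * (t * ‖α‖) - k) ^ q), ← hp1, Finset.sum_mul]
            refine Finset.sum_le_sum fun i _ => mul_le_mul_of_nonneg_left ?_ (hp i)
            refine Real.rpow_le_rpow hv (le_trans ?_ (hc _ _ (by positivity))) hq0.le
            have e1 : |c (α (yhat i))| ≤ k :=
              Finset.single_le_sum (f := fun i => |c (α (yhat i))|) (fun i _ => abs_nonneg _)
                (Finset.mem_univ i)
            linarith [le_abs_self (c (α (yhat i)))]
          have h2 := (mul_le_mul_of_nonneg_left h1 hη0.le).trans h
          have h3 := Real.rpow_le_rpow (by positivity) h2 (z := 1 / q) (by positivity)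
          rw [Real.mul_rpow hη0.le (by positivity), hcancel' hv] at h3
          have h4 : C * x.2 ^ (1 / q) * ‖α‖ = η ^ (1 / q) * (C * (t * ‖α‖)) := by
            rw [← htη]
            ring
          linarith
      have hlim := le_of_forall_gt_rpow (q := q) (c := k) (δ := 0)
        (u := C * x.2 ^ (1 / q) * ‖α‖) (v := R ^ (1 / q)) hq.le fun e he => by
          refine (hη (min e 1) (lt_min he one_pos) (min_le_right _ _)).trans ?_
          have := Real.rpow_le_rpow (by positivity) (min_le_left e 1) (z := 1 / q) (by positivity)
          have := mul_le_mul_of_nonneg_left this hk0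
          linarith
      rw [Real.zero_rpow (by positivity), mul_zero, add_zero] at hlim
      rw [← h0, Real.zero_rpow (by positivity), zero_add]
      have := Real.rpow_le_rpow (by positivity) hlim hq0.le
      rwa [hcancel hR0] at this
    · choose s hs hgr using hf.exists_direction
      -- Equality in Minkowski's inequality requires displacements proportional to `f`; this `l`
      -- makes the total cost equal to `δ`. Atoms with `f = 0` do not move.
      set l := (x.2 / S) ^ (1 / q) with hl
      have hl0 : 0 ≤ l := by positivity
      have h := shifted_risk_le hVp hq.le hR hx zero_le_one le_rfl (s := fun i => s (α (yhat i)))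
        (t := fun i => f (α (yhat i)) * l) (fun i => hs _)
        (fun i => mul_nonneg (hf.nonneg _) hl0) (by
          simp only [Real.mul_rpow (hf.nonneg _) hl0, ← mul_assoc]
          rw [← Finset.sum_mul, ← hS, hl, hcancel (by positivity), one_mul,
            mul_div_cancel₀ _ h0.ne'])
      rw [sub_self, zero_mul, zero_add, one_mul] at h
      refine le_trans ?_ h
      have h1 : S ^ (1 / q) + C * x.2 ^ (1 / q) * ‖α‖ = S ^ (1 / q) * (1 + C * l * ‖α‖) := by
        rw [hl, Real.div_rpow hδ hS0]
        have : 0 < S ^ (1 / q) := by positivity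
        field_simp
      rw [h1, Real.mul_rpow (by positivity) (by positivity), hcancel hS0, hS, Finset.sum_mul]
      refine Finset.sum_le_sum fun i _ => ?_
      rw [mul_assoc, ← Real.mul_rpow (hf.nonneg _) (by positivity)]
      refine mul_le_mul_of_nonneg_left (Real.rpow_le_rpow
        (mul_nonneg (hf.nonneg _) (by positivity)) ?_ hq0.le) (hp i)
      rcases eq_or_lt_of_le (hf.nonneg (α (yhat i))) with hz | hz
      · rw [← hz, zero_mul]
        exact hf.nonneg _
      · have := hgr _ hz (f (α (yhat i)) * l * ‖α‖) (by positivity)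
        linarith

end WorstCase

/-! ### Assembly of the three cases -/

lemma EquivalentProblems.of_eq {X : Type*} {A : Set X} {F G : X → EReal} (h : ∀ α, F α = G α) :
    EquivalentProblems A F G := by
  rw [funext h]
  exact ⟨fun _ _ => rfl, rfl⟩

lemma powCost_one (E : Type*) [NormedAddCommGroup E] :
    (fun y₁ y₂ : E => ‖y₁ - y₂‖) = powCost 1 := by
  funext y₁ y₂
  rw [powCost, Real.rpow_one]

end UnionBall

end

theorem mainTheorem4 {E : Type*} [NormedAddCommGroup E] [NormedSpace ℝ E] [FiniteDimensional ℝ E]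
    [MeasurableSpace E] [BorelSpace E] {N : ℕ} (yhat : Fin N → E)
    (V : Set ((Fin N → ℝ) × ℝ)) (hV : Convex ℝ V)
    (hVp : ∀ x ∈ V, (∀ i, 0 ≤ x.1 i) ∧ ∑ i, x.1 i = 1)
    (hVne : (UnionBall.nonnegPart V).Nonempty)
    (A : Set (StrongDual ℝ E)) :
    (∀ ℓ : ℝ → ℝ, ConvexOn ℝ univ ℓ → (∃ K : ℝ≥0, LipschitzWith K ℓ) →
      (∀ α ∈ A, ∀ Q ∈ UnionBall.unionBall (fun y₁ y₂ : E => ‖y₁ - y₂‖) yhat V,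
        Integrable (fun y => ℓ (α y)) Q) ∧
      UnionBall.EquivalentProblems A
        (UnionBall.worstCase (fun y₁ y₂ : E => ‖y₁ - y₂‖) yhat V ℓ)
        (UnionBall.robustLipschitz yhat V ℓ) ∧
      UnionBall.SolvedBy A
        (UnionBall.worstCase (fun y₁ y₂ : E => ‖y₁ - y₂‖) yhat V ℓ)
        (UnionBall.feasibleLipschitz A yhat ℓ) (UnionBall.objLipschitz V) ∧
      (Convex ℝ A → UnionBall.IsConvexProgram
        (UnionBall.feasibleLipschitz A yhat ℓ) (UnionBall.objLipschitz V))) ∧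
    (∀ q C : ℝ, 1 < q → 0 < C → ∀ ℓ : ℝ → ℝ, UnionBall.IsAffineOrAbsLoss C ℓ →
      (∀ α ∈ A, ∀ Q ∈ UnionBall.unionBall (UnionBall.powCost q) yhat V,
        Integrable (fun y => ℓ (α y)) Q) ∧
      UnionBall.EquivalentProblems A
        (UnionBall.worstCase (UnionBall.powCost q) yhat V ℓ)
        (UnionBall.robustAffine q C yhat V ℓ) ∧
      UnionBall.SolvedBy A
        (UnionBall.worstCase (UnionBall.powCost q) yhat V ℓ)
        (UnionBall.feasibleAffine A yhat ℓ) (UnionBall.objAffine q C V) ∧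
      (Convex ℝ A → UnionBall.IsConvexProgram
        (UnionBall.feasibleAffine A yhat ℓ) (UnionBall.objAffine q C V))) ∧
    (∀ q C : ℝ, 1 < q → 0 < C → ∀ ℓ : ℝ → ℝ, UnionBall.IsPowerLoss q C ℓ →
      (∀ α ∈ A, ∀ Q ∈ UnionBall.unionBall (UnionBall.powCost q) yhat V,
        Integrable (fun y => ℓ (α y)) Q) ∧
      UnionBall.EquivalentProblems A
        (UnionBall.worstCase (UnionBall.powCost q) yhat V ℓ)
        (UnionBall.robustPower q C yhat V ℓ) ∧
      UnionBall.SolvedBy A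
        (UnionBall.worstCase (UnionBall.powCost q) yhat V ℓ)
        (UnionBall.feasiblePower q A yhat ℓ) (UnionBall.objPower q C V) ∧
      (Convex ℝ A → UnionBall.IsConvexProgram
        (UnionBall.feasiblePower q A yhat ℓ) (UnionBall.objPower q C V))) := by
  refine ⟨fun ℓ hℓ hL => ?_, fun q C hq hC ℓ hℓ => ?_, fun q C hq hC ℓ hℓ => ?_⟩
  · rw [UnionBall.powCost_one]
    have heq := UnionBall.worstCase_eq_robustLipschitz (yhat := yhat) hVp hℓ hL
    refine ⟨fun α _ Q hQ => ?_, .of_eq heq, ?_,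
      fun hA => UnionBall.isConvexProgram_lipschitz yhat V hA hℓ⟩
    · obtain ⟨x, _, hQx⟩ := UnionBall.exists_of_mem_unionBall hQ
      exact UnionBall.integrable_of_lipschitz le_rfl (UnionBall.lipConst_nonneg ℓ)
        (UnionBall.abs_sub_le_lipConst hL) hQx α
    · rw [funext heq]
      exact UnionBall.solvedBy_lipschitz hVp A ℓ
  · obtain ⟨hc, hl, hd⟩ := hℓ.properties hC
    have heq := UnionBall.worstCase_eq_robustAffine (yhat := yhat) hVp hq hC hl hd
    refine ⟨fun α _ Q hQ => ?_, .of_eq heq, ?_,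
      fun hA => UnionBall.isConvexProgram_affine hq hC yhat hVne hA hc⟩
    · obtain ⟨x, _, hQx⟩ := UnionBall.exists_of_mem_unionBall hQ
      exact UnionBall.integrable_of_lipschitz hq.le hC.le hl hQx α
    · rw [funext heq]
      exact UnionBall.solvedBy_affine hq hC hV hVp hVne A ℓ
  · obtain ⟨f, hf, rfl⟩ := hℓ.exists_base hC
    have heq := UnionBall.worstCase_eq_robustPower (yhat := yhat) hVp hq hC hf
    refine ⟨fun α _ Q hQ => ?_, .of_eq heq, ?_,
      fun hA => UnionBall.isConvexProgram_power hq hC yhat hVne hA hf.nonneg hf.convexOn⟩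
    · obtain ⟨x, _, hQx⟩ := UnionBall.exists_of_mem_unionBall hQ
      exact UnionBall.integrable_rpow_of_lipschitz hq.le hC.le hf.abs_sub_le hf.nonneg hQx α
    · rw [funext heq]
      exact UnionBall.solvedBy_power hq hC hV hVp hVne A hf.nonneg
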